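/- Let $K$ be a field, $S=K[x_1,\dots,x_6]$ with the standard grading, and $I=\langle x_1x_2,\,x_2x_3,\,x_3x_4,\,x_4x_5,\,x_5x_6\rangle$. For $k\ge 1$ let $\beta_{i,j}(S/I^k)$ be the number of basis elements of degree $j$ in the $i$-th module of a minimal graded free resolution of $S/I^k$. For integers $d_0<d_1<\dots<d_c$ ($c\ge 0$), the (normalised) pure diagram of $d=(d_0,\dots,d_c)$ is the diagram whose only nonzero entries are $$\pi(d)_{i,d_i}=\frac{\prod_{l\ne 0}(d_l-d_0)}{\prod_{l\neq i}|d_l-d_i|}\qquad(0\le i\le c),$$ so that $\pi(d)_{0,d_0}=1$. A decomposition of a diagram $\beta$ is an expression of $\beta$ as a finite sum of pure diagrams with nonnegative real weights. For $k\geq 1$ let $\pi_1(k),\dots,\pi_8(k)$ be the pure diagrams of the degree sequences $$\begin{aligned}&(0,2k,2k+1,2k+2),\quad (0,2k,2k+1,2k+3),\quad (0,2k,2k+2,2k+3),\\ &(0,2k,2k+1,2k+2,2k+3),\quad (0,2k,2k+1,2k+2,2k+4),\quad (0,2k,2k+1,2k+3,2k+4),\\ &(0,2k,2k+2,2k+3,2k+4),\quad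 (0,2k,2k+1,2k+2,2k+3,2k+4).\end{aligned}$$ A minimal graded free resolution of $S/I^k$ (with modules of finite rank) exists, and for any such resolution the following hold. 1. For every $k\ge 1$ the nonzero Betti numbers of $S/I^k$ are among $\beta_{0,0}=1$; $$\beta_{1,2k}=\tbinom{k+4}{4},\quad \beta_{2,2k+1}=4\tbinom{k+3}{4},\quad \beta_{3,2k+2}=6\tbinom{k+2}{4},\quad \beta_{4,2k+3}=4\tbinom{k+1}{4},\quad \beta_{5,2k+4}=\tbinom{k}{4};$$ $$\beta_{2,2k+2}=k(k+2),\quad \beta_{3,2k+3}=2k(k+1),\quad \beta_{4,2k+4}=k^2.$$ 2. For every $k\ge 1$, every decomposition of $\beta(S/I^k)$ into pure diagrams uses, with positive weight, only pure diagrams among $\pi_1(k),\dots,\pi_8(k)$. 3. For every $k\ge 3$ the polytope $$P_k=\Big\{w\in\mathbb R_{\ge 0}^8 : \beta(S/I^k)=w_1\pi_1(k)+\dots+w_8\pi_8(k)\Big\}$$ is a (nondegenerate) triangle whose vertices are $$h_1(k)=\Big(0,0,\tfrac{k+2}{2k+3},w_4(k),\tfrac{(2k+5)(k-1)}{(2k+1)(k+2)(k+1)},\tfrac{(4k+5)(k+1)}{(2k+3)(2k+1)(k+2)},0,w_8(k)\Big),$$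 $$h_2(k)=\Big(0,\tfrac{2(k+2)(k+1)}{(2k+3)(2k+1)},0,w_4(k),\tfrac{(2k+5)(k-1)}{(2k+1)(k+2)(k+1)},\tfrac{(k+1)(k-1)}{(2k+3)(2k+1)(k+2)},\tfrac1{2k+3},w_8(k)\Big),$$ $$h_3(k)=\Big(\tfrac{k+2}{2k+1},0,0,w_4(k),\tfrac{k^2-7}{(2k+1)(k+2)(k+1)},\tfrac{k+1}{(2k+3)(k+2)},\tfrac1{2k+3},w_8(k)\Big),$$ where $$w_4(k)=\frac{(7k+15)(k-1)(k-2)}{4(2k+3)(2k+1)(k+1)},\qquad w_8(k)=\frac{(k-1)(k-2)(k-3)}{4(2k+3)(2k+1)(k+1)}.$$ -/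

import Mathlib

noncomputable section

open MvPolynomial

/-- A minimal graded free resolution
`⋯ → F₂ → F₁ → F₀ → S ⧸ J → 0` of `S ⧸ J` over `S = K[x₁,…,xₙ]` with its standard grading.
The module `F i` is free with a finite basis indexed by `Fin (rank i)`, whose `a`-th element is
homogeneous of degree `deg i a`; that is, `F i = ⨁ₐ S(-deg i a)`.  The differential
`F (i+1) → F i` is multiplication by the matrix `d i`. -/
structure MinimalFreeResolution (K : Type*) [Field K] (n : ℕ)
    (J : Ideal (MvPolynomial (Fin n) K)) where
  /-- the rank of the `i`-th free module -/
  rank : ℕ → ℕ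
  /-- the degrees of the homogeneous basis elements -/
  deg : (i : ℕ) → Fin (rank i) → ℕ
  /-- the matrix of the differential `F (i+1) → F i` -/
  d : (i : ℕ) → Matrix (Fin (rank i)) (Fin (rank (i + 1))) (MvPolynomial (Fin n) K)
  /-- the augmentation `F 0 → S ⧸ J` -/
  aug : (Fin (rank 0) → MvPolynomial (Fin n) K) →ₗ[MvPolynomial (Fin n) K]
    (MvPolynomial (Fin n) K ⧸ J)
  /-- the augmentation preserves degrees -/
  aug_homogeneous : ∀ a, ∃ p : MvPolynomial (Fin n) K,
    p.IsHomogeneous (deg 0 a) ∧ aug (Pi.single a 1) = Ideal.Quotient.mk J p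
  /-- the differentials preserve degrees -/
  d_homogeneous : ∀ i a b, d i a b ≠ 0 →
    ∃ m, deg (i + 1) b = deg i a + m ∧ (d i a b).IsHomogeneous m
  aug_surjective : Function.Surjective aug
  exact_zero : Function.Exact (d 0).mulVecLin aug
  exact_succ : ∀ i, Function.Exact (d (i + 1)).mulVecLin (d i).mulVecLin
  /-- minimality: the matrices have entries in the ideal `⟨x₁,…,xₙ⟩` -/
  minimal : ∀ i a b, constantCoeff (d i a b) = 0

/-- The graded Betti number `β_{i,j}`: the number of basis elements of degree `j` in the `i`-th
module of the minimal graded free resolution. -/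
def MinimalFreeResolution.betti {K : Type*} [Field K] {n : ℕ}
    {J : Ideal (MvPolynomial (Fin n) K)} (F : MinimalFreeResolution K n J) (i j : ℕ) : ℕ :=
  (Finset.univ.filter fun a : Fin (F.rank i) => F.deg i a = j).card

/-- The ideal `⟨x₁x₂, x₂x₃, x₃x₄, x₄x₅, x₅x₆⟩` of `K[x₁,…,x₆]`. -/
def pathIdeal (K : Type*) [Field K] : Ideal (MvPolynomial (Fin 6) K) :=
  Ideal.span {X 0 * X 1, X 1 * X 2, X 2 * X 3, X 3 * X 4, X 4 * X 5}

/-- A degree sequence `d₀ < d₁ < ⋯ < d_c` with `c ≥ 0`. -/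
def IsDegreeSequence (d : List ℕ) : Prop :=
  d ≠ [] ∧ d.Pairwise (· < ·)

/-- The pure diagram of the degree sequence `d = (d₀ < ⋯ < d_c)`, normalised so that its entry in
column `0` is one.  Its nonzero entries are at the positions `(i, dᵢ)` (column `i`, degree `dᵢ`, so
row `dᵢ - i`), and they are `∏_{l ≠ 0} (d_l - d₀) / ∏_{l ≠ i} |d_l - dᵢ|`. -/
def pureDiagram (d : List ℕ) (i j : ℕ) : ℝ :=
  if d[i]? = some j then
    (d.tail.map fun l => (l : ℝ) - (d.headD 0 : ℝ)).prod /
      ((d.eraseIdx i).map fun l => |(l : ℝ) - (j : ℝ)|).prod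
  else 0

/-- `w` is a decomposition of the diagram `β` into pure diagrams: a finite sum of pure diagrams
with nonnegative real weights. -/
def IsDecomposition (β : ℕ → ℕ → ℕ) (w : List ℕ →₀ ℝ) : Prop :=
  (∀ d ∈ w.support, IsDegreeSequence d) ∧ (∀ d, 0 ≤ w d) ∧
    ∀ i j, (β i j : ℝ) = w.sum fun d c => c * pureDiagram d i j

/-- The polytope of weight vectors `(w₁,…,w_m)` of the decompositions of `β` of the form
`w₁ π₁ + ⋯ + w_m π_m`, where `π_s` is the pure diagram of the degree sequence `D s`. -/
def decompositionPolytope {m : ℕ} (β : ℕ → ℕ → ℕ) (D : Fin m → List ℕ) : Set (Fin m → ℝ) :=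
  {w | (∀ s, 0 ≤ w s) ∧ ∀ i j, (β i j : ℝ) = ∑ s, w s * pureDiagram (D s) i j}

/-- The degree sequences of the eight translated pure diagrams `π₁(k), …, π₈(k)`. -/
def translatedSequence (k : ℕ) : Fin 8 → List ℕ :=
  ![[0, 2 * k, 2 * k + 1, 2 * k + 2],
    [0, 2 * k, 2 * k + 1, 2 * k + 3],
    [0, 2 * k, 2 * k + 2, 2 * k + 3],
    [0, 2 * k, 2 * k + 1, 2 * k + 2, 2 * k + 3],
    [0, 2 * k, 2 * k + 1, 2 * k + 2, 2 * k + 4],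
    [0, 2 * k, 2 * k + 1, 2 * k + 3, 2 * k + 4],
    [0, 2 * k, 2 * k + 2, 2 * k + 3, 2 * k + 4],
    [0, 2 * k, 2 * k + 1, 2 * k + 2, 2 * k + 3, 2 * k + 4]]

/-- The entries of row `2k - 1` of the Betti diagram of `S ⧸ I ^ k`, by column. -/
def pathRow₁ (k : ℕ) : ℕ → ℕ
  | 1 => (k + 4).choose 4
  | 2 => 4 * (k + 3).choose 4
  | 3 => 6 * (k + 2).choose 4
  | 4 => 4 * (k + 1).choose 4
  | 5 => k.choose 4
  | _ => 0

/-- The entries of row `2k` of the Betti diagram of `S ⧸ I ^ k`, by column. -/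
def pathRow₂ (k : ℕ) : ℕ → ℕ
  | 2 => k * (k + 2)
  | 3 => 2 * k * (k + 1)
  | 4 => k ^ 2
  | _ => 0

/-- The Betti diagram of `S ⧸ I ^ k` for `k ≥ 1`: the entry in column `i` and degree `j` stands in
row `j - i`. -/
def pathDiagram (k i j : ℕ) : ℕ :=
  if i = 0 ∧ j = 0 then 1
  else if j + 1 = i + 2 * k then pathRow₁ k i
  else if j = i + 2 * k then pathRow₂ k i
  else 0

/-- The common fourth coordinate of the vertices. -/
def wCoord₄ (k : ℝ) : ℝ :=
  (7 * k + 15) * (k - 1) * (k - 2) / (4 * (2 * k + 3) * (2 * k + 1) * (k + 1))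

/-- The common eighth coordinate of the vertices. -/
def wCoord₈ (k : ℝ) : ℝ :=
  (k - 1) * (k - 2) * (k - 3) / (4 * (2 * k + 3) * (2 * k + 1) * (k + 1))

/-- The first vertex. -/
def hVertex₁ (k : ℝ) : Fin 8 → ℝ :=
  ![0, 0, (k + 2) / (2 * k + 3), wCoord₄ k,
    (2 * k + 5) * (k - 1) / ((2 * k + 1) * (k + 2) * (k + 1)),
    (4 * k + 5) * (k + 1) / ((2 * k + 3) * (2 * k + 1) * (k + 2)), 0, wCoord₈ k]

/-- The second vertex. -/
def hVertex₂ (k : ℝ) : Fin 8 → ℝ :=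
  ![0, 2 * (k + 2) * (k + 1) / ((2 * k + 3) * (2 * k + 1)), 0, wCoord₄ k,
    (2 * k + 5) * (k - 1) / ((2 * k + 1) * (k + 2) * (k + 1)),
    (k + 1) * (k - 1) / ((2 * k + 3) * (2 * k + 1) * (k + 2)), 1 / (2 * k + 3), wCoord₈ k]

/-- The third vertex. -/
def hVertex₃ (k : ℝ) : Fin 8 → ℝ :=
  ![(k + 2) / (2 * k + 1), 0, 0, wCoord₄ k,
    (k ^ 2 - 7) / ((2 * k + 1) * (k + 2) * (k + 1)),
    (k + 1) / ((2 * k + 3) * (k + 2)), 1 / (2 * k + 3), wCoord₈ k]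

end

/-!
The Betti numbers do not depend on the minimal resolution, because a degree-preserving lift of the
identity between two of them is invertible modulo the variables.

The `k`-th power of the path ideal is generated by the monomials `e₁ ^ a₁ ⋯ e₅ ^ a₅`, where the `aᵢ`
add up to `k` and `eᵢ = xᵢxᵢ₊₁`.  In lexicographic order, the ideal of the preceding generators has
with respect to each generator a colon ideal which depends only on which of `a₂, …, a₅` are nonzero
and which has an explicit minimal resolution.  When the generators are attached one after the other
by mapping cones nothing cancels, because the multidegrees that could cancel never agree.  The Betti
numbers are thus sums over the weak compositions of `k` into five parts.

The moment `∑ (-1) ^ i (j - 2k) ^ 2 β_{i,j}` vanishes on the Betti diagram and on every `πₛ`, as on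
all diagrams of codimension at least three.  The other pure diagrams supported on the same positions
are shorter, and on these it is positive.

The weights of a decomposition solve a linear system of rank six.  A solution is determined by its
first three coordinates, and each vertex has a single nonzero entry there, so that up to scaling
these coordinates are barycentric.
-/

open MvPolynomial
open scoped Matrix

attribute [local instance] MvPolynomial.gradedAlgebra

section HomogeneousVectors

variable {σ R : Type*} [CommSemiring R] {ι κ μ : Type*} {δ : ι → ℕ} {ε : κ → ℕ} {η : μ → ℕ} {j : ℕ}

theorem coe_decompose_homogeneousSubmodule (p : MvPolynomial σ R) (n : ℕ) :
    (DirectSum.decompose (homogeneousSubmodule σ R) p n : MvPolynomial σ R) =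
      homogeneousComponent n p :=
  decomposition.decompose'_apply p n

theorem homogeneousComponent_mul_of_isHomogeneous {p : MvPolynomial σ R} {m : ℕ}
    (hp : p.IsHomogeneous m) (q : MvPolynomial σ R) (n : ℕ) :
    homogeneousComponent n (p * q) =
      if m ≤ n then p * homogeneousComponent (n - m) q else 0 := by
  classical
  simpa only [coe_decompose_homogeneousSubmodule] using
    DirectSum.coe_decompose_mul_of_left_mem (homogeneousSubmodule σ R) (b := q) n
      ((mem_homogeneousSubmodule m p).2 hp)

/-- `y` is a homogeneous element of degree `j` of the graded free module `⨁ₐ S(-δ a)`. -/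
def IsHomogeneousVec (δ : ι → ℕ) (j : ℕ) (y : ι → MvPolynomial σ R) : Prop :=
  ∀ a, y a ≠ 0 → ∃ m, j = δ a + m ∧ (y a).IsHomogeneous m

/-- The component of degree `j` of an element of the graded free module `⨁ₐ S(-δ a)`. -/
noncomputable def vecComponent (δ : ι → ℕ) (j : ℕ) (y : ι → MvPolynomial σ R) :
    ι → MvPolynomial σ R :=
  fun a => if δ a ≤ j then homogeneousComponent (j - δ a) (y a) else 0

/-- `A` is the matrix of a degree-preserving map `⨁_b S(-ε b) → ⨁ₐ S(-δ a)`. -/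
def IsGradedMatrix (δ : ι → ℕ) (ε : κ → ℕ) (A : Matrix ι κ (MvPolynomial σ R)) : Prop :=
  ∀ b, IsHomogeneousVec δ (ε b) (A.col b)

theorem isHomogeneousVec_vecComponent (δ : ι → ℕ) (j : ℕ) (y : ι → MvPolynomial σ R) :
    IsHomogeneousVec δ j (vecComponent δ j y) := by
  intro a ha
  by_cases h : δ a ≤ j
  · simp only [vecComponent, if_pos h]
    exact ⟨j - δ a, by lia, homogeneousComponent_isHomogeneous _ _⟩
  · simp [vecComponent, h] at ha

theorem IsHomogeneousVec.vecComponent_eq {y : ι → MvPolynomial σ R}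
    (hy : IsHomogeneousVec δ j y) : vecComponent δ j y = y := by
  funext a
  by_cases h0 : y a = 0
  · simp [vecComponent, h0]
  · obtain ⟨m, rfl, hm⟩ := hy a h0
    simpa [vecComponent] using homogeneousComponent_eq_self hm

theorem IsGradedMatrix.vecComponent_mulVec [Fintype κ] {A : Matrix ι κ (MvPolynomial σ R)}
    (hA : IsGradedMatrix δ ε A) (j : ℕ) (y : κ → MvPolynomial σ R) :
    vecComponent δ j (A.mulVec y) = A.mulVec (vecComponent ε j y) := by
  funext a
  suffices h : ∀ b, (if δ a ≤ j then homogeneousComponent (j - δ a) (A a b * y b) else 0) =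
      A a b * if ε b ≤ j then homogeneousComponent (j - ε b) (y b) else 0 by
    simp only [vecComponent, Matrix.mulVec, dotProduct, map_sum, ← h, Finset.sum_ite_irrel,
      Finset.sum_const_zero]
  intro b
  by_cases h0 : A a b = 0
  · simp [h0]
  · obtain ⟨m, hm, hom⟩ := hA b a h0
    rw [Matrix.col_apply] at hom
    rw [homogeneousComponent_mul_of_isHomogeneous hom, hm, Nat.sub_sub]
    split_ifs <;> lia

theorem IsGradedMatrix.mulVec [Fintype κ] {A : Matrix ι κ (MvPolynomial σ R)}
    (hA : IsGradedMatrix δ ε A) {y : κ → MvPolynomial σ R} (hy : IsHomogeneousVec ε j y) :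
    IsHomogeneousVec δ j (A.mulVec y) := by
  rw [← hy.vecComponent_eq, ← hA.vecComponent_mulVec]
  exact isHomogeneousVec_vecComponent _ _ _

theorem IsGradedMatrix.mul [Fintype κ] {A : Matrix ι κ (MvPolynomial σ R)}
    {B : Matrix κ μ (MvPolynomial σ R)} (hA : IsGradedMatrix δ ε A) (hB : IsGradedMatrix ε η B) :
    IsGradedMatrix δ η (A * B) :=
  fun b => hA.mulVec (hB b)

theorem IsGradedMatrix.exists_isGradedMatrix_mul_eq [Fintype κ]
    {A : Matrix ι κ (MvPolynomial σ R)} {C : Matrix ι μ (MvPolynomial σ R)}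
    (hA : IsGradedMatrix δ ε A) (hC : IsGradedMatrix δ η C) {B : Matrix κ μ (MvPolynomial σ R)}
    (hB : A * B = C) :
    ∃ B' : Matrix κ μ (MvPolynomial σ R), IsGradedMatrix ε η B' ∧ A * B' = C := by
  refine ⟨Matrix.of fun b c => vecComponent ε (η c) (B.col c) b,
    fun c => isHomogeneousVec_vecComponent _ _ _, Matrix.ext_col fun c => ?_⟩
  calc A.mulVec (vecComponent ε (η c) (B.col c))
      = vecComponent δ (η c) ((A * B).col c) := (hA.vecComponent_mulVec _ _).symm
    _ = C.col c := by rw [hB, (hC c).vecComponent_eq]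

theorem IsGradedMatrix.eq_of_constantCoeff_ne_zero {A : Matrix ι κ (MvPolynomial σ R)}
    (hA : IsGradedMatrix δ ε A) {a : ι} {b : κ} (h : constantCoeff (A a b) ≠ 0) : δ a = ε b := by
  obtain ⟨m, hm, hom⟩ := hA b a fun h0 => h (by rw [← Matrix.col_apply A, h0, map_zero])
  obtain rfl | hpos := Nat.eq_zero_or_pos m
  · exact hm.symm
  · exact absurd (hom.coeff_eq_zero (by simpa using hpos.ne)) h

end HomogeneousVectors

theorem card_filter_le_of_mul_eq_one {K α β : Type*} [CommRing K] [Nontrivial K] [Fintype α]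
    [DecidableEq α] [Fintype β] {A : Matrix α β K} {B : Matrix β α K} (h : A * B = 1)
    {δ : α → ℕ} {ε : β → ℕ} (hB : ∀ b a, B b a ≠ 0 → ε b = δ a) (j : ℕ) :
    (Finset.univ.filter fun a => δ a = j).card ≤ (Finset.univ.filter fun b => ε b = j).card := by
  classical
  let A' : Matrix {a // δ a = j} {b // ε b = j} K := A.submatrix (↑) (↑)
  let B' : Matrix {b // ε b = j} {a // δ a = j} K := B.submatrix (↑) (↑)
  have hA'B' : A' * B' = 1 := by
    rw [← Matrix.submatrix_one (fun a : {a // δ a = j} => a.1) Subtype.val_injective, ← h]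
    refine Matrix.ext fun a a' => Fintype.sum_of_injective _ Subtype.val_injective _ _
      (fun b hb => ?_) fun _ => rfl
    by_contra hne
    exact hb ⟨⟨b, (hB b a' (right_ne_zero_of_mul hne)).trans a'.2⟩, rfl⟩
  have hinj : Function.Injective B'.mulVecLin := by
    refine Function.LeftInverse.injective (g := A'.mulVecLin) fun x => ?_
    simp [Matrix.mulVec_mulVec, hA'B']
  simpa only [Fintype.card_subtype] using card_le_of_injective K B'.mulVecLin hinj

theorem exists_seq_of_forall_exists_succ {X : ℕ → Type*} {P : ∀ i, X i → Prop}
    {r : ∀ i, X i → X (i + 1) → Prop} {x₀ : X 0} (h₀ : P 0 x₀)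
    (hsucc : ∀ i x, P i x → ∃ y, P (i + 1) y ∧ r i x y) :
    ∃ f : ∀ i, X i, f 0 = x₀ ∧ (∀ i, P i (f i)) ∧ ∀ i, r i (f i) (f (i + 1)) := by
  choose next hnext hr using hsucc
  let f : ∀ i, {x : X i // P i x} := fun i =>
    Nat.rec ⟨x₀, h₀⟩ (fun i x => ⟨next i x.1 x.2, hnext i x.1 x.2⟩) i
  exact ⟨fun i => (f i).1, rfl, fun i => (f i).2, fun i => hr i _ (f i).2⟩

namespace MinimalFreeResolution

variable {K : Type*} [Field K] {n : ℕ} {J : Ideal (MvPolynomial (Fin n) K)}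

local notation "S" => MvPolynomial (Fin n) K

theorem isGradedMatrix_d (F : MinimalFreeResolution K n J) (i : ℕ) :
    IsGradedMatrix (F.deg i) (F.deg (i + 1)) (F.d i) :=
  fun b a h => F.d_homogeneous i a b h

theorem d_mul_d (F : MinimalFreeResolution K n J) (i : ℕ) : F.d i * F.d (i + 1) = 0 := by
  refine Matrix.ext_of_mulVec_single fun b => ?_
  rw [← Matrix.mulVec_mulVec, Matrix.zero_mulVec]
  exact (F.exact_succ i).apply_apply_eq_zero (Pi.single b 1)

theorem map_constantCoeff_d (F : MinimalFreeResolution K n J) (i : ℕ) :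
    (F.d i).map constantCoeff = 0 :=
  Matrix.ext fun a b => F.minimal i a b

theorem exists_d_zero_mul_eq (F : MinimalFreeResolution K n J) {m : Type*}
    {A : Matrix (Fin (F.rank 0)) m S} (hA : ∀ b, F.aug (A.col b) = 0) :
    ∃ B : Matrix (Fin (F.rank 1)) m S, F.d 0 * B = A := by
  choose B hB using fun b => (F.exact_zero _).1 (hA b)
  exact ⟨Matrix.of fun a b => B b a, Matrix.ext_col hB⟩

theorem exists_d_succ_mul_eq (F : MinimalFreeResolution K n J) {i : ℕ} {m : Type*}
    {A : Matrix (Fin (F.rank (i + 1))) m S} (hA : F.d i * A = 0) :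
    ∃ B : Matrix (Fin (F.rank (i + 2))) m S, F.d (i + 1) * B = A := by
  choose B hB using fun b => (F.exact_succ i (A.col b)).1 (congrArg (Matrix.col · b) hA)
  exact ⟨Matrix.of fun a b => B b a, Matrix.ext_col hB⟩

theorem aug_d_zero_col (F : MinimalFreeResolution K n J) (b : Fin (F.rank 1)) :
    F.aug ((F.d 0).col b) = 0 := by
  simpa using F.exact_zero.apply_apply_eq_zero (Pi.single b 1)

theorem exists_aug_eq_mk_mulVec (F : MinimalFreeResolution K n J) :
    ∃ q : Matrix Unit (Fin (F.rank 0)) S, IsGradedMatrix (fun _ => 0) (F.deg 0) q ∧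
      ∀ v, F.aug v = Ideal.Quotient.mk J (q.mulVec v ()) := by
  choose q hq haug using F.aug_homogeneous
  let Q : Matrix Unit (Fin (F.rank 0)) S := Matrix.of fun _ b => q b
  refine ⟨Q, fun b _ _ => ⟨F.deg 0 b, (zero_add _).symm, hq b⟩, fun v => ?_⟩
  suffices h : F.aug = J.mkQ ∘ₗ LinearMap.proj () ∘ₗ Q.mulVecLin from LinearMap.congr_fun h v
  refine LinearMap.pi_ext' fun b => LinearMap.ext_ring ?_
  rw [LinearMap.comp_apply, LinearMap.single_apply, haug]
  simp [Q]

theorem exists_isHomogeneousVec_aug_eq (F : MinimalFreeResolution K n J)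
    (hJ : J.IsHomogeneous (homogeneousSubmodule (Fin n) K)) {p : S} {j : ℕ}
    (hp : p.IsHomogeneous j) :
    ∃ w, IsHomogeneousVec (F.deg 0) j w ∧ F.aug w = Ideal.Quotient.mk J p := by
  obtain ⟨q, hq, haug⟩ := F.exists_aug_eq_mk_mulVec
  obtain ⟨w, hw⟩ := F.aug_surjective (Ideal.Quotient.mk J p)
  refine ⟨vecComponent (F.deg 0) j w, isHomogeneousVec_vecComponent _ _ _, ?_⟩
  rw [haug, Ideal.Quotient.eq] at hw ⊢
  have hcomp := hJ j hw
  rw [coe_decompose_homogeneousSubmodule, map_sub, homogeneousComponent_eq_self hp] at hcomp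
  simpa [← hq.vecComponent_mulVec, vecComponent] using hcomp

/-- A chain map between two resolutions of `S ⧸ J` which preserves degrees and lifts the identity
of `S ⧸ J`. -/
structure ComparisonMap (F G : MinimalFreeResolution K n J) where
  /-- the matrix of the map `F i → G i` -/
  hom : ∀ i, Matrix (Fin (G.rank i)) (Fin (F.rank i)) S
  isGradedMatrix_hom : ∀ i, IsGradedMatrix (G.deg i) (F.deg i) (hom i)
  aug_hom : ∀ v, G.aug ((hom 0).mulVec v) = F.aug v
  comm : ∀ i, G.d i * hom (i + 1) = hom i * F.d i

theorem exists_comparison_zero (F G : MinimalFreeResolution K n J)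
    (hJ : J.IsHomogeneous (homogeneousSubmodule (Fin n) K)) :
    ∃ Φ : Matrix (Fin (G.rank 0)) (Fin (F.rank 0)) S,
      IsGradedMatrix (G.deg 0) (F.deg 0) Φ ∧ ∀ v, G.aug (Φ.mulVec v) = F.aug v := by
  choose q hq haug using F.aug_homogeneous
  choose w hw hGw using fun b => G.exists_isHomogeneousVec_aug_eq hJ (hq b)
  refine ⟨Matrix.of fun a b => w b a, hw, fun v => ?_⟩
  suffices h : G.aug ∘ₗ (Matrix.of fun a b => w b a).mulVecLin = F.aug from LinearMap.congr_fun h v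
  refine LinearMap.pi_ext' fun b => LinearMap.ext_ring ?_
  simpa only [LinearMap.comp_apply, LinearMap.single_apply, Matrix.mulVecLin_apply,
    Matrix.mulVec_single_one, haug] using! hGw b

theorem exists_comparison_succ (F G : MinimalFreeResolution K n J) {i : ℕ}
    {Φ : Matrix (Fin (G.rank i)) (Fin (F.rank i)) S}
    (hΦ : IsGradedMatrix (G.deg i) (F.deg i) Φ)
    (hex : ∃ Ψ : Matrix (Fin (G.rank (i + 1))) (Fin (F.rank (i + 1))) S,
      G.d i * Ψ = Φ * F.d i) :
    ∃ Ψ : Matrix (Fin (G.rank (i + 1))) (Fin (F.rank (i + 1))) S,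
      (IsGradedMatrix (G.deg (i + 1)) (F.deg (i + 1)) Ψ ∧
        ∃ Ω : Matrix (Fin (G.rank (i + 2))) (Fin (F.rank (i + 2))) S,
          G.d (i + 1) * Ω = Ψ * F.d (i + 1)) ∧ G.d i * Ψ = Φ * F.d i := by
  obtain ⟨Ψ₀, hΨ₀⟩ := hex
  obtain ⟨Ψ, hΨ, hcomm⟩ :=
    (G.isGradedMatrix_d i).exists_isGradedMatrix_mul_eq (hΦ.mul (F.isGradedMatrix_d i)) hΨ₀
  refine ⟨Ψ, ⟨hΨ, G.exists_d_succ_mul_eq ?_⟩, hcomm⟩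
  rw [← Matrix.mul_assoc, hcomm, Matrix.mul_assoc, F.d_mul_d, Matrix.mul_zero]

theorem nonempty_comparisonMap (F G : MinimalFreeResolution K n J)
    (hJ : J.IsHomogeneous (homogeneousSubmodule (Fin n) K)) : Nonempty (ComparisonMap F G) := by
  obtain ⟨Φ₀, hΦ₀, haug⟩ := exists_comparison_zero F G hJ
  have lift₀ := G.exists_d_zero_mul_eq (A := Φ₀ * F.d 0) fun b =>
    (haug _).trans (F.aug_d_zero_col b)
  obtain ⟨Φ, rfl, hΦ, hcomm⟩ := exists_seq_of_forall_exists_succ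
    (P := fun i Φ => IsGradedMatrix (G.deg i) (F.deg i) Φ ∧
      ∃ Ψ : Matrix (Fin (G.rank (i + 1))) (Fin (F.rank (i + 1))) S, G.d i * Ψ = Φ * F.d i)
    ⟨hΦ₀, lift₀⟩ fun i Φ hΦ => exists_comparison_succ F G hΦ.1 hΦ.2
  exact ⟨⟨Φ, fun i => (hΦ i).1, haug, hcomm⟩⟩

theorem exists_homotopy (F : MinimalFreeResolution K n J)
    {Θ : ∀ i, Matrix (Fin (F.rank i)) (Fin (F.rank i)) S}
    (hΘ : ∀ i, F.d i * Θ (i + 1) = Θ i * F.d i)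
    {H₀ : Matrix (Fin (F.rank 1)) (Fin (F.rank 0)) S}
    (hH₀ : F.d 0 * H₀ = Θ 0) (i : ℕ) :
    ∃ (H : Matrix (Fin (F.rank (i + 1))) (Fin (F.rank i)) S)
      (H' : Matrix (Fin (F.rank (i + 2))) (Fin (F.rank (i + 1))) S),
      Θ (i + 1) = F.d (i + 1) * H' + H * F.d i := by
  suffices h : ∃ H : Matrix (Fin (F.rank (i + 1))) (Fin (F.rank i)) S,
      F.d i * (Θ (i + 1) - H * F.d i) = 0 by
    obtain ⟨H, hH⟩ := h
    obtain ⟨H', hH'⟩ := F.exists_d_succ_mul_eq hH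
    exact ⟨H, H', sub_eq_iff_eq_add.1 hH'.symm⟩
  induction i with
  | zero => exact ⟨H₀, by rw [Matrix.mul_sub, hΘ, ← Matrix.mul_assoc, hH₀, sub_self]⟩
  | succ i ih =>
    obtain ⟨H, hH⟩ := ih
    obtain ⟨H', hH'⟩ := F.exists_d_succ_mul_eq hH
    refine ⟨H', ?_⟩
    rw [Matrix.mul_sub, hΘ, ← Matrix.mul_assoc, hH', ← Matrix.sub_mul, sub_sub_cancel,
      Matrix.mul_assoc, F.d_mul_d, Matrix.mul_zero]

theorem map_constantCoeff_eq_zero (F : MinimalFreeResolution K n J)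
    {Θ : ∀ i, Matrix (Fin (F.rank i)) (Fin (F.rank i)) S}
    (haug : ∀ v, F.aug ((Θ 0).mulVec v) = 0)
    (hΘ : ∀ i, F.d i * Θ (i + 1) = Θ i * F.d i) (i : ℕ) : (Θ i).map constantCoeff = 0 := by
  obtain ⟨H₀, hH₀⟩ := F.exists_d_zero_mul_eq (A := Θ 0) fun b => by
    simpa using haug (Pi.single b 1)
  cases i with
  | zero => rw [← hH₀, Matrix.map_mul, F.map_constantCoeff_d, Matrix.zero_mul]
  | succ i =>
    obtain ⟨H, H', h⟩ := F.exists_homotopy hΘ hH₀ i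
    rw [h, Matrix.map_add _ (map_add _), Matrix.map_mul, Matrix.map_mul, F.map_constantCoeff_d,
      F.map_constantCoeff_d, Matrix.zero_mul, Matrix.mul_zero, add_zero]

theorem ComparisonMap.map_constantCoeff_mul {F G : MinimalFreeResolution K n J}
    (Φ : ComparisonMap F G) (Ψ : ComparisonMap G F) (i : ℕ) :
    (Ψ.hom i).map constantCoeff * (Φ.hom i).map constantCoeff = 1 := by
  have h := F.map_constantCoeff_eq_zero (Θ := fun i => Ψ.hom i * Φ.hom i - 1)
    (fun v => by simp [Matrix.sub_mulVec, ← Matrix.mulVec_mulVec, Ψ.aug_hom, Φ.aug_hom])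
    (fun i => by
      rw [Matrix.mul_sub, Matrix.sub_mul, ← Matrix.mul_assoc, Ψ.comm, Matrix.mul_assoc, Φ.comm,
        Matrix.mul_assoc, Matrix.mul_one, Matrix.one_mul])
    i
  rwa [Matrix.map_sub _ (map_sub _), Matrix.map_mul,
    Matrix.map_one _ (map_zero _) (map_one _), sub_eq_zero] at h

theorem betti_le (F G : MinimalFreeResolution K n J)
    (hJ : J.IsHomogeneous (homogeneousSubmodule (Fin n) K)) (i j : ℕ) :
    F.betti i j ≤ G.betti i j := by
  obtain ⟨Φ⟩ := nonempty_comparisonMap F G hJ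
  obtain ⟨Ψ⟩ := nonempty_comparisonMap G F hJ
  exact card_filter_le_of_mul_eq_one (Φ.map_constantCoeff_mul Ψ i)
    (fun _ _ => (Φ.isGradedMatrix_hom i).eq_of_constantCoeff_ne_zero) j

theorem betti_eq (F G : MinimalFreeResolution K n J)
    (hJ : J.IsHomogeneous (homogeneousSubmodule (Fin n) K)) (i j : ℕ) :
    F.betti i j = G.betti i j :=
  le_antisymm (betti_le F G hJ i j) (betti_le G F hJ i j)

end MinimalFreeResolution

theorem exists_ne_zero_of_mulVec_ne_zero {R A B : Type*} [NonUnitalNonAssocSemiring R]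
    [Fintype B] {M : Matrix A B R} {v : B → R} {a : A} (h : (M *ᵥ v) a ≠ 0) :
    ∃ b, M a b ≠ 0 ∧ v b ≠ 0 := by
  obtain ⟨b, -, hb⟩ := Finset.exists_ne_zero_of_sum_ne_zero h
  exact ⟨b, left_ne_zero_of_mul hb, right_ne_zero_of_mul hb⟩

theorem mulVec_congr_of_ne_zero {R A B : Type*} [NonUnitalNonAssocSemiring R] [Fintype B]
    {M N : Matrix A B R} {v : B → R} (h : ∀ b, v b ≠ 0 → ∀ a, M a b = N a b) :
    M *ᵥ v = N *ᵥ v := by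
  ext a
  refine Finset.sum_congr rfl fun b _ => ?_
  by_cases hb : v b = 0
  · simp [hb]
  · exact congrArg (· * v b) (h b hb a)

/-- The vectors supported on the basis elements of degree at most `α`.  They are the coordinates
of the elements of multidegree `α` in a free module with basis elements of degrees `deg`. -/
def strand (K : Type*) [Semiring K] {B Γ : Type*} [LE Γ] (deg : B → Γ) (α : Γ) :
    Submodule K (B → K) :=
  Submodule.pi {b | ¬deg b ≤ α} fun _ => ⊥

section Strand

variable {K : Type*} [Semiring K] {A B Γ : Type*}

theorem mem_strand_iff [LE Γ] {deg : B → Γ} {α : Γ} {v : B → K} :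
    v ∈ strand K deg α ↔ ∀ b, v b ≠ 0 → deg b ≤ α := by
  simp only [strand, Submodule.mem_pi, Set.mem_ofPred_eq, Submodule.mem_bot, ne_eq]
  exact forall_congr' fun b => not_imp_comm

theorem single_mem_strand [LE Γ] [DecidableEq B] {deg : B → Γ} {α : Γ} {b : B}
    (hb : deg b ≤ α) (r : K) : Pi.single b r ∈ strand K deg α := by
  refine mem_strand_iff.2 fun e he => ?_
  have eq_b : e = b := not_imp_comm.1 (fun hne => Pi.single_eq_of_ne hne _) he
  rwa [eq_b]

theorem mulVec_mem_strand [AddCommMonoid Γ] [PartialOrder Γ] [IsOrderedAddMonoid Γ] [Fintype B]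
    {δ : A → Γ} {ε : B → Γ} {f β : Γ} {φ : Matrix A B K} {v : B → K}
    (hφ : ∀ a b, φ a b ≠ 0 → δ a ≤ ε b + f) (hv : v ∈ strand K ε β) :
    φ *ᵥ v ∈ strand K δ (β + f) := by
  refine mem_strand_iff.2 fun a ha => ?_
  obtain ⟨b, hab, hb⟩ := exists_ne_zero_of_mulVec_ne_zero ha
  exact (hφ a b hab).trans (by gcongr; exact mem_strand_iff.1 hv b hb)

end Strand

/-- A minimal free resolution of the quotient by a monomial ideal, graded by exponent vectors.  The
ideal is given by the set `J` of exponents of its monomials.  The matrix of the differential from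
`b` to `a` is `d a b` times the monomial of exponent `deg b - deg a`, so that the piece of degree
`α` of the resolution is the complex of vector spaces on the basis elements of degree `≤ α`. -/
structure MonomialResolution (K : Type*) [Field K] (n : ℕ) (J : Set (Fin n → ℕ)) where
  /-- the basis elements of all the free modules -/
  B : Type
  [fintype : Fintype B]
  /-- the homological degree -/
  hom : B → ℕ
  /-- the exponent vector of a basis element -/
  deg : B → Fin n → ℕ
  /-- the only basis element of homological degree zero -/
  base : B
  /-- the coefficients of the differential -/
  d : Matrix B B K
  hom_eq_zero_iff : ∀ b, hom b = 0 ↔ b = base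
  deg_base : deg base = 0
  hom_eq_of_ne_zero : ∀ a b, d a b ≠ 0 → hom b = hom a + 1
  deg_lt_of_ne_zero : ∀ a b, d a b ≠ 0 → deg a < deg b
  d_mul_d : d * d = 0
  mem_of_mulVec_base_ne_zero : ∀ α, ∀ v ∈ strand K deg α, (d *ᵥ v) base ≠ 0 → α ∈ J
  exact : ∀ α, ∀ v ∈ strand K deg α, d *ᵥ v = 0 → (v base ≠ 0 → α ∈ J) →
    ∃ w ∈ strand K deg α, d *ᵥ w = v

/-- The shift of the table entry of a basis element by the exponent `f` and by one homological
degree. -/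
def shiftEntry {n : ℕ} (f : Fin n → ℕ) (q : ℕ × (Fin n → ℕ)) : ℕ × (Fin n → ℕ) :=
  (q.1 + 1, q.2 + f)

namespace MonomialResolution

attribute [instance] MonomialResolution.fintype

variable {K : Type*} [Field K] {n : ℕ} {J J₁ : Set (Fin n → ℕ)}

/-- The homological degrees and exponent vectors of the basis elements. -/
def table (F : MonomialResolution K n J) : Multiset (ℕ × (Fin n → ℕ)) :=
  Finset.univ.val.map fun b => (F.hom b, F.deg b)

theorem mem_table (F : MonomialResolution K n J) (b : F.B) : (F.hom b, F.deg b) ∈ F.table :=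
  Multiset.mem_map_of_mem _ (Finset.mem_univ b)

theorem hom_base (F : MonomialResolution K n J) : F.hom F.base = 0 :=
  (F.hom_eq_zero_iff _).2 rfl

theorem d_apply_base (F : MonomialResolution K n J) (a : F.B) : F.d a F.base = 0 := by
  by_contra h
  simpa [F.hom_base] using F.hom_eq_of_ne_zero _ _ h

theorem col_mem_strand (F : MonomialResolution K n J) (b : F.B) :
    F.d.col b ∈ strand K F.deg (F.deg b) :=
  mem_strand_iff.2 fun a ha => (F.deg_lt_of_ne_zero a b ha).le

theorem d_mulVec_col (F : MonomialResolution K n J) (b : F.B) : F.d *ᵥ F.d.col b = 0 := by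
  classical
  rw [← Matrix.mulVec_single_one, Matrix.mulVec_mulVec, F.d_mul_d, Matrix.zero_mulVec]

/-- The resolution of the ring itself. -/
def unit (K : Type*) [Field K] (n : ℕ) : MonomialResolution K n ∅ where
  B := Unit
  hom _ := 0
  deg _ := 0
  base := ()
  d := 0
  hom_eq_zero_iff := by simp
  deg_base := rfl
  hom_eq_of_ne_zero := by simp
  deg_lt_of_ne_zero := by simp
  d_mul_d := by simp
  mem_of_mulVec_base_ne_zero := by simp
  exact α v _ _ h0 := ⟨0, zero_mem _, by
    rw [Matrix.mulVec_zero]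
    exact funext fun _ => (not_not.1 h0).symm⟩

theorem exists_d_mulVec_eq_of_hom (F : MonomialResolution K n J) {α : Fin n → ℕ} {m : ℕ}
    {v : F.B → K} (hm : ∀ b, v b ≠ 0 → F.hom b = m) (hv : v ∈ strand K F.deg α)
    (hdv : F.d *ᵥ v = 0) (hbase : v F.base ≠ 0 → α ∈ J) :
    ∃ w : F.B → K, (∀ b, w b ≠ 0 → F.hom b = m + 1 ∧ F.deg b ≤ α) ∧ F.d *ᵥ w = v := by
  obtain ⟨w, hw, rfl⟩ := F.exact α v hv hdv hbase
  refine ⟨fun b => if F.hom b = m + 1 then w b else 0, fun b hb => ?_, ?_⟩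
  · simp only [ne_eq, ite_eq_right_iff, Classical.not_imp] at hb
    exact ⟨hb.1, mem_strand_iff.1 hw b hb.2⟩
  ext a
  by_cases ha : F.hom a = m
  · refine Finset.sum_congr rfl fun b _ => ?_
    by_cases hab : F.d a b = 0
    · simp [hab]
    · simp only [F.hom_eq_of_ne_zero _ _ hab, ha, if_true]
  · rw [not_imp_comm.1 (hm a) ha]
    by_contra hne
    obtain ⟨b, hab, hb⟩ := exists_ne_zero_of_mulVec_ne_zero hne
    have := F.hom_eq_of_ne_zero _ _ hab
    simp only [ne_eq, ite_eq_right_iff, Classical.not_imp] at hb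
    omega

/-- The matrix `φ` maps `G` to `F` preserving the homological degrees and raising the degrees by
`f`, and its part of homological degree zero is the multiplication by the monomial of exponent
`f`. -/
structure IsGradedLift (F : MonomialResolution K n J) (G : MonomialResolution K n J₁)
    (f : Fin n → ℕ) (φ : Matrix F.B G.B K) : Prop where
  hom_eq : ∀ a b, φ a b ≠ 0 → F.hom a = G.hom b
  deg_le : ∀ a b, φ a b ≠ 0 → F.deg a ≤ G.deg b + f
  base : φ F.base G.base = 1

/-- A chain map lifting the multiplication by the monomial of exponent `f`. -/
structure IsLift (F : MonomialResolution K n J) (G : MonomialResolution K n J₁)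
    (f : Fin n → ℕ) (φ : Matrix F.B G.B K) : Prop extends IsGradedLift F G f φ where
  comm : F.d * φ = φ * G.d

section Lift

variable {F : MonomialResolution K n J} {G : MonomialResolution K n J₁} {f : Fin n → ℕ}
  {φ : Matrix F.B G.B K}

theorem IsGradedLift.mulVec_base (hφ : IsGradedLift F G f φ) (u : G.B → K) :
    (φ *ᵥ u) F.base = u G.base := by
  refine (Fintype.sum_eq_single G.base fun b hb => ?_).trans (by simp [hφ.base])
  by_contra hne
  have hom_b := hφ.hom_eq _ _ (left_ne_zero_of_mul hne)
  rw [F.hom_base] at hom_b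
  exact hb ((G.hom_eq_zero_iff b).1 hom_b.symm)

theorem isGradedLift_single [DecidableEq F.B] [DecidableEq G.B] (f : Fin n → ℕ) :
    IsGradedLift F G f (Matrix.single F.base G.base 1) := by
  have eq_base {a b} (h : Matrix.single F.base G.base (1 : K) a b ≠ 0) :
      a = F.base ∧ b = G.base := by
    by_contra hne
    exact h (Matrix.single_apply_of_ne _ _ _ _ _ fun hab => hne ⟨hab.1.symm, hab.2.symm⟩)
  constructor
  · intro a b h
    rw [(eq_base h).1, (eq_base h).2, F.hom_base, G.hom_base]
  · intro a b h
    rw [(eq_base h).1, (eq_base h).2, F.deg_base]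
    exact zero_le
  · exact Matrix.single_apply_same _ _ _

/-- The column added to a partial lift is a preimage of the cycle `φ (d b)`. -/
theorem IsGradedLift.exists_col (hφ : IsGradedLift F G f φ) (hJ : ∀ γ ∈ J₁, γ + f ∈ J) {m : ℕ}
    (hcomm : ∀ b, G.hom b ≤ m → ∀ a, (F.d * φ) a b = (φ * G.d) a b) {b : G.B}
    (hb : G.hom b = m + 1) :
    ∃ w : F.B → K, (∀ a, w a ≠ 0 → F.hom a = m + 1 ∧ F.deg a ≤ G.deg b + f) ∧
      F.d *ᵥ w = φ *ᵥ G.d.col b := by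
  classical
  have hom_of_col {e} (he : G.d.col b e ≠ 0) : G.hom e = m := by
    have := G.hom_eq_of_ne_zero e b he
    omega
  refine F.exists_d_mulVec_eq_of_hom (fun a ha => ?_)
    (mulVec_mem_strand hφ.deg_le (G.col_mem_strand b)) ?_ fun h => ?_
  · obtain ⟨e, hae, he⟩ := exists_ne_zero_of_mulVec_ne_zero ha
    rw [hφ.hom_eq a e hae, hom_of_col he]
  · calc F.d *ᵥ φ *ᵥ G.d.col b = (F.d * φ) *ᵥ G.d.col b := Matrix.mulVec_mulVec _ _ _
      _ = (φ * G.d) *ᵥ G.d.col b :=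
        mulVec_congr_of_ne_zero fun e he => hcomm e (hom_of_col he).le
      _ = 0 := by rw [← Matrix.mulVec_mulVec, G.d_mulVec_col, Matrix.mulVec_zero]
  · rw [hφ.mulVec_base, ← Matrix.mulVec_single_one] at h
    exact hJ _ (G.mem_of_mulVec_base_ne_zero _ _ (single_mem_strand le_rfl 1) h)

theorem IsGradedLift.exists_extend (hφ : IsGradedLift F G f φ) (hJ : ∀ γ ∈ J₁, γ + f ∈ J)
    {m : ℕ} (hcomm : ∀ b, G.hom b ≤ m → ∀ a, (F.d * φ) a b = (φ * G.d) a b) :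
    ∃ ψ, IsGradedLift F G f ψ ∧
      ∀ b, G.hom b ≤ m + 1 → ∀ a, (F.d * ψ) a b = (ψ * G.d) a b := by
  choose! w hw hdw using fun b (hb : G.hom b = m + 1) => hφ.exists_col hJ hcomm hb
  let ψ : Matrix F.B G.B K := fun a b => if G.hom b = m + 1 then w b a else φ a b
  have ψ_of_eq {b} (hb : G.hom b = m + 1) (a) : ψ a b = w b a := if_pos hb
  have ψ_of_ne {b} (hb : G.hom b ≠ m + 1) (a) : ψ a b = φ a b := if_neg hb
  refine ⟨ψ, ⟨fun a b h => ?_, fun a b h => ?_, ?_⟩, fun b hb a => ?_⟩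
  · by_cases hb : G.hom b = m + 1
    · rw [hb, (hw b hb a (ψ_of_eq hb a ▸ h)).1]
    · exact hφ.hom_eq a b (ψ_of_ne hb a ▸ h)
  · by_cases hb : G.hom b = m + 1
    · exact (hw b hb a (ψ_of_eq hb a ▸ h)).2
    · exact hφ.deg_le a b (ψ_of_ne hb a ▸ h)
  · rw [ψ_of_ne (by rw [G.hom_base]; omega), hφ.base]
  have mul_d : (ψ * G.d) a b = (φ * G.d) a b := by
    refine congrFun (mulVec_congr_of_ne_zero (v := G.d.col b) fun e he => ψ_of_ne ?_) a
    have := G.hom_eq_of_ne_zero e b he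
    omega
  rw [mul_d]
  by_cases h : G.hom b = m + 1
  · have col_eq : ψ.col b = w b := funext (ψ_of_eq h)
    change (F.d *ᵥ ψ.col b) a = _
    rw [col_eq, hdw b h]
    rfl
  · have col_eq : ψ.col b = φ.col b := funext (ψ_of_ne h)
    change (F.d *ᵥ ψ.col b) a = _
    rw [col_eq, ← hcomm b (by omega) a]
    rfl

theorem exists_isLift (F : MonomialResolution K n J) (G : MonomialResolution K n J₁)
    {f : Fin n → ℕ} (hJ : ∀ γ ∈ J₁, γ + f ∈ J) : ∃ φ, IsLift F G f φ := by
  classical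
  have partial_lift (m : ℕ) : ∃ φ, IsGradedLift F G f φ ∧
      ∀ b, G.hom b ≤ m → ∀ a, (F.d * φ) a b = (φ * G.d) a b := by
    induction m with
    | zero =>
      refine ⟨_, isGradedLift_single f, fun b hb a => ?_⟩
      obtain rfl := (G.hom_eq_zero_iff b).1 (Nat.le_zero.1 hb)
      simp [Matrix.mul_apply, Matrix.single_apply, d_apply_base, ite_and]
    | succ m ih =>
      obtain ⟨φ, hφ, hcomm⟩ := ih
      exact hφ.exists_extend hJ hcomm
  obtain ⟨φ, hφ, hcomm⟩ := partial_lift (Finset.univ.sup G.hom)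
  exact ⟨φ, hφ, Matrix.ext fun a b => hcomm b (Finset.le_sup (Finset.mem_univ b)) a⟩

theorem eq_zero_of_mem_strand_add {β : Fin n → ℕ} (hf : ¬f ≤ β) {y : G.B → K}
    (hy : y ∈ strand K (fun b => G.deg b + f) β) : y = 0 := by
  ext b
  by_contra hb
  exact hf (le_add_self.trans (mem_strand_iff.1 hy b hb))

/-- The preimage of `y` can be adjusted at the base so that `x + φ u` augments to zero. -/
theorem IsLift.exists_d_mulVec_eq_and_base (hφ : IsLift F G f φ)
    (hJ : ∀ γ, γ ∈ J₁ ↔ γ + f ∈ J) {β : Fin n → ℕ} {x : F.B → K} {y : G.B → K}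
    (hx : x ∈ strand K F.deg (β + f)) (hy : y ∈ strand K G.deg β)
    (hxy : F.d *ᵥ x + φ *ᵥ y = 0) (hdy : G.d *ᵥ y = 0) :
    ∃ u ∈ strand K G.deg β, G.d *ᵥ u = y ∧ ((x + φ *ᵥ u) F.base ≠ 0 → β + f ∈ J) := by
  classical
  obtain ⟨u, hu, hdu⟩ := G.exact β y hy hdy fun hybase =>
    (hJ β).2 <| F.mem_of_mulVec_base_ne_zero _ x hx fun hzero => hybase <| by
      simpa [hzero, hφ.mulVec_base] using congrFun hxy F.base
  refine ⟨u + Pi.single G.base (-(x F.base + u G.base)),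
    add_mem hu (single_mem_strand (by rw [G.deg_base]; exact zero_le) _), ?_, fun h => ?_⟩
  · ext a
    simp [Matrix.mulVec_add, hdu, G.d_apply_base]
  · exact (h (by simp [hφ.mulVec_base, add_comm])).elim

theorem IsLift.exists_preimage (hφ : IsLift F G f φ) (hJ : ∀ γ, γ ∈ J₁ ↔ γ + f ∈ J)
    {α : Fin n → ℕ} {x : F.B → K} {y : G.B → K} (hx : x ∈ strand K F.deg α)
    (hy : y ∈ strand K (fun b => G.deg b + f) α) (hxy : F.d *ᵥ x + φ *ᵥ y = 0)
    (hdy : G.d *ᵥ y = 0) (hbase : x F.base ≠ 0 → α ∈ J ∨ f ≤ α) :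
    ∃ z ∈ strand K F.deg α, ∃ u ∈ strand K (fun b => G.deg b + f) α,
      G.d *ᵥ u = y ∧ F.d *ᵥ z = x + φ *ᵥ u := by
  by_cases hf : f ≤ α
  · obtain ⟨β, rfl⟩ : ∃ β, α = β + f := ⟨α - f, (tsub_add_cancel_of_le hf).symm⟩
    have mem_shift {u : G.B → K} :
        u ∈ strand K (fun b => G.deg b + f) (β + f) ↔ u ∈ strand K G.deg β := by
      simp only [mem_strand_iff, add_le_add_iff_right]
    obtain ⟨u, hu, hdu, hubase⟩ :=
      hφ.exists_d_mulVec_eq_and_base hJ hx (mem_shift.1 hy) hxy hdy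
    obtain ⟨z, hz, hdz⟩ := F.exact (β + f) (x + φ *ᵥ u)
      (add_mem hx (mulVec_mem_strand hφ.deg_le hu))
      (by rw [Matrix.mulVec_add, Matrix.mulVec_mulVec, hφ.comm, ← Matrix.mulVec_mulVec, hdu, hxy])
      hubase
    exact ⟨z, hz, u, mem_shift.2 hu, hdu, hdz⟩
  · obtain rfl := eq_zero_of_mem_strand_add hf hy
    obtain ⟨z, hz, hdz⟩ := F.exact α x hx (by simpa using hxy) fun h => (hbase h).resolve_right hf
    exact ⟨z, hz, 0, zero_mem _, by simp, by simp [hdz]⟩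

/-- The mapping cone of the multiplication by the monomial of exponent `f`.  The hypothesis `hdeg`
makes it minimal. -/
def cone (hφ : IsLift F G f φ) (hJ : ∀ γ, γ ∈ J₁ ↔ γ + f ∈ J)
    (hdeg : ∀ a b, F.hom a = G.hom b → F.deg a ≠ G.deg b + f) :
    MonomialResolution K n {γ | γ ∈ J ∨ f ≤ γ} where
  B := F.B ⊕ G.B
  hom := Sum.elim F.hom fun b => G.hom b + 1
  deg := Sum.elim F.deg fun b => G.deg b + f
  base := Sum.inl F.base
  d := Matrix.fromBlocks F.d φ 0 (-G.d)
  hom_eq_zero_iff := by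
    rintro (a | b)
    · simp [F.hom_eq_zero_iff]
    · simp
  deg_base := F.deg_base
  hom_eq_of_ne_zero := by
    rintro (a | a) (b | b) h
    · exact F.hom_eq_of_ne_zero a b h
    · exact congrArg (· + 1) (hφ.hom_eq a b h).symm
    · exact absurd rfl h
    · exact congrArg (· + 1) (G.hom_eq_of_ne_zero a b (neg_ne_zero.1 h))
  deg_lt_of_ne_zero := by
    rintro (a | a) (b | b) h
    · exact F.deg_lt_of_ne_zero a b h
    · exact lt_of_le_of_ne (hφ.deg_le a b h) (hdeg a b (hφ.hom_eq a b h))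
    · exact absurd rfl h
    · exact add_lt_add_left (G.deg_lt_of_ne_zero a b (neg_ne_zero.1 h)) f
  d_mul_d := by
    rw [Matrix.fromBlocks_multiply]
    simp [F.d_mul_d, G.d_mul_d, hφ.comm]
  mem_of_mulVec_base_ne_zero α v hv h := by
    obtain ⟨x, y, rfl⟩ : ∃ x y, v = Sum.elim x y := ⟨_, _, (Sum.elim_comp_inl_inr v).symm⟩
    refine or_iff_not_imp_right.2 fun hf =>
      F.mem_of_mulVec_base_ne_zero α x (mem_strand_iff.2 fun b => mem_strand_iff.1 hv (.inl b)) ?_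
    obtain rfl : y = 0 :=
      eq_zero_of_mem_strand_add hf (mem_strand_iff.2 fun b => mem_strand_iff.1 hv (.inr b))
    simpa [Matrix.fromBlocks_mulVec] using h
  exact α v hv hdv hbase := by
    obtain ⟨x, y, rfl⟩ : ∃ x y, v = Sum.elim x y := ⟨_, _, (Sum.elim_comp_inl_inr v).symm⟩
    simp only [Matrix.fromBlocks_mulVec, Sum.elim_comp_inl, Sum.elim_comp_inr,
      Matrix.zero_mulVec, zero_add, Matrix.neg_mulVec] at hdv
    obtain ⟨z, hz, u, hu, hdu, hdz⟩ := hφ.exists_preimage hJ (x := x) (y := y)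
      (mem_strand_iff.2 fun b => mem_strand_iff.1 hv (.inl b))
      (mem_strand_iff.2 fun b => mem_strand_iff.1 hv (.inr b))
      (funext fun a => congrFun hdv (.inl a))
      (funext fun a => neg_eq_zero.1 (congrFun hdv (.inr a))) hbase
    refine ⟨Sum.elim z (-u), mem_strand_iff.2 ?_, ?_⟩
    · rintro (b | b) hb
      · exact mem_strand_iff.1 hz b hb
      · exact mem_strand_iff.1 hu b (neg_ne_zero.1 hb)
    · rw [Matrix.fromBlocks_mulVec]
      simp [Matrix.mulVec_neg, Matrix.neg_mulVec, hdz, hdu]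

theorem table_cone (hφ : IsLift F G f φ) (hJ : ∀ γ, γ ∈ J₁ ↔ γ + f ∈ J)
    (hdeg : ∀ a b, F.hom a = G.hom b → F.deg a ≠ G.deg b + f) :
    (cone hφ hJ hdeg).table = F.table + G.table.map (shiftEntry f) := by
  have univ_val : (Finset.univ : Finset (F.B ⊕ G.B)).val =
      Finset.univ.val.map Sum.inl + Finset.univ.val.map Sum.inr := Finset.val_disjSum _ _
  change (Finset.univ : Finset (F.B ⊕ G.B)).val.map (fun b =>
    (Sum.elim F.hom (fun b => G.hom b + 1) b, Sum.elim F.deg (fun b => G.deg b + f) b)) = _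
  rw [univ_val, table, table, Multiset.map_add, Multiset.map_map, Multiset.map_map,
    Multiset.map_map]
  rfl

end Lift

end MonomialResolution

/-- The quotient by the monomial ideal with the set `J` of exponents has a minimal free resolution
whose basis elements have the homological degrees and exponent vectors listed in `M`. -/
def HasTable (K : Type*) [Field K] {n : ℕ} (J : Set (Fin n → ℕ))
    (M : Multiset (ℕ × (Fin n → ℕ))) : Prop :=
  ∃ F : MonomialResolution K n J, F.table = M

section HasTable

variable {K : Type*} [Field K] {n : ℕ}

theorem hasTable_empty : HasTable K (∅ : Set (Fin n → ℕ)) {(0, 0)} :=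
  ⟨MonomialResolution.unit K n, rfl⟩

theorem HasTable.cone {J J₁ : Set (Fin n → ℕ)} {M N : Multiset (ℕ × (Fin n → ℕ))}
    (hM : HasTable K J M) (hN : HasTable K J₁ N) {f : Fin n → ℕ}
    (hJ : ∀ γ, γ ∈ J₁ ↔ γ + f ∈ J)
    (hdisj : ∀ p ∈ M, ∀ q ∈ N, p.1 = q.1 → p.2 ≠ q.2 + f) :
    HasTable K {γ | γ ∈ J ∨ f ≤ γ} (M + N.map (shiftEntry f)) := by
  obtain ⟨F, rfl⟩ := hM
  obtain ⟨G, rfl⟩ := hN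
  obtain ⟨φ, hφ⟩ := F.exists_isLift G fun γ => (hJ γ).1
  exact ⟨.cone hφ hJ fun a b => hdisj _ (F.mem_table a) _ (G.mem_table b),
    MonomialResolution.table_cone hφ hJ _⟩

/-- The ideal is built up by adding the generators in the order of decreasing keys. -/
theorem hasTable_of_colon {ι κ : Type*} [LinearOrder κ] {key : ι → κ} (hkey : key.Injective)
    {f : ι → Fin n → ℕ} {C : ι → Set (Fin n → ℕ)} {T : ι → Multiset (ℕ × (Fin n → ℕ))}
    (s : Finset ι) (hf : ∀ a ∈ s, f a ≠ 0) (hT : ∀ a ∈ s, HasTable K (C a) (T a))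
    (hC : ∀ a ∈ s, ∀ γ, γ ∈ C a ↔ ∃ b ∈ s, key a < key b ∧ f b ≤ γ + f a)
    (hdisj : ∀ a ∈ s, ∀ b ∈ s, key a < key b → ∀ q ∈ T a, ∀ p ∈ T b, p.1 + 1 = q.1 →
      p.2 + f b ≠ q.2 + f a) :
    HasTable K {γ | ∃ a ∈ s, f a ≤ γ} ({(0, 0)} + ∑ a ∈ s, (T a).map (shiftEntry (f a))) := by
  classical
  induction s using Finset.induction_on_min_value key with
  | empty => simpa using hasTable_empty
  | insert a s ha hmin ih =>
    have key_lt : ∀ b ∈ s, key a < key b := fun b hb =>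
      (hmin b hb).lt_of_ne fun h => ha (hkey h ▸ hb)
    simp only [Finset.forall_mem_insert] at hf hT hC hdisj
    have ih := ih hf.2 hT.2 (fun b hb γ => by simpa [(hmin b hb).not_gt] using hC.2 b hb γ)
      fun b hb => (hdisj.2 b hb).2
    have hJ (γ) : γ ∈ C a ↔ γ + f a ∈ {γ | ∃ b ∈ s, f b ≤ γ} := by
      rw [hC.1]
      simp only [Finset.exists_mem_insert, lt_irrefl, false_and, false_or, Set.mem_ofPred_eq]
      exact exists_congr fun b => and_congr_right fun hb => and_iff_right (key_lt b hb)
    convert ih.cone hT.1 hJ fun p hp q hq hpq => ?_ using 1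
    · ext γ
      simp [or_comm]
    · rw [Finset.sum_insert ha, add_assoc, add_comm (Multiset.map _ _)]
    · rcases Multiset.mem_add.1 hp with hp | hp
      · rw [Multiset.mem_singleton.1 hp]
        exact fun h => hf.1 (add_eq_zero.1 h.symm).2
      · obtain ⟨b, hb, hp⟩ := Multiset.mem_sum.1 hp
        obtain ⟨p, hpT, rfl⟩ := Multiset.mem_map.1 hp
        exact hdisj.1.2 b hb (key_lt b hb) q hq p hpT hpq

end HasTable

/-- The finitely supported form of an exponent vector. -/
noncomputable def exponent {n : ℕ} (γ : Fin n → ℕ) : Fin n →₀ ℕ :=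
  Finsupp.equivFunOnFinite.symm γ

section Exponent

variable {n : ℕ}

theorem exponent_injective : Function.Injective (exponent (n := n)) :=
  Finsupp.equivFunOnFinite.symm.injective

@[simp] theorem coe_exponent (γ : Fin n → ℕ) : ⇑(exponent γ) = γ :=
  rfl

@[simp] theorem exponent_coe (γ : Fin n →₀ ℕ) : exponent ⇑γ = γ :=
  Finsupp.equivFunOnFinite_symm_coe γ

theorem exponent_le_exponent {γ δ : Fin n → ℕ} : exponent γ ≤ exponent δ ↔ γ ≤ δ :=
  Iff.rfl

theorem exponent_sub (γ δ : Fin n → ℕ) : exponent (γ - δ) = exponent γ - exponent δ :=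
  Finsupp.ext fun _ => rfl

theorem degree_exponent (γ : Fin n → ℕ) : (exponent γ).degree = ∑ i, γ i :=
  Finsupp.degree_eq_sum _

end Exponent

namespace MonomialResolution

variable {K : Type*} [Field K] {n : ℕ} {J : Set (Fin n → ℕ)} (F : MonomialResolution K n J)

/-- The matrix of the differential over the polynomial ring. -/
noncomputable def differential : Matrix F.B F.B (MvPolynomial (Fin n) K) :=
  Matrix.of fun a b => monomial (exponent (F.deg b - F.deg a)) (F.d a b)

/-- The component of multidegree `α` of a vector over the polynomial ring. -/
noncomputable def component (α : Fin n → ℕ) (v : F.B → MvPolynomial (Fin n) K) : F.B → K :=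
  open Classical in fun b => if F.deg b ≤ α then coeff (exponent (α - F.deg b)) (v b) else 0

theorem component_of_le {α : Fin n → ℕ} {b : F.B} (hb : F.deg b ≤ α)
    (v : F.B → MvPolynomial (Fin n) K) :
    F.component α v b = coeff (exponent (α - F.deg b)) (v b) :=
  if_pos hb

theorem component_of_not_le {α : Fin n → ℕ} {b : F.B} (hb : ¬F.deg b ≤ α)
    (v : F.B → MvPolynomial (Fin n) K) : F.component α v b = 0 :=
  if_neg hb

theorem component_mem_strand (α : Fin n → ℕ) (v : F.B → MvPolynomial (Fin n) K) :
    F.component α v ∈ strand K F.deg α :=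
  mem_strand_iff.2 fun _ hb => not_imp_comm.1 (F.component_of_not_le · v) hb

theorem component_zero (α : Fin n → ℕ) : F.component α 0 = 0 := by
  ext b
  simp [component]

theorem component_base (α : Fin n → ℕ) (v : F.B → MvPolynomial (Fin n) K) :
    F.component α v F.base = coeff (exponent α) (v F.base) := by
  simp [component, F.deg_base, show 0 ≤ α from zero_le]

theorem component_injective {v w : F.B → MvPolynomial (Fin n) K}
    (h : ∀ α, F.component α v = F.component α w) : v = w := by
  ext b γ
  simpa [component] using congrFun (h (⇑γ + F.deg b)) b

theorem component_differential_mulVec (α : Fin n → ℕ) (v : F.B → MvPolynomial (Fin n) K) :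
    F.component α (F.differential *ᵥ v) = F.d *ᵥ F.component α v := by
  ext a
  by_cases ha : F.deg a ≤ α
  · rw [F.component_of_le ha, Matrix.mulVec, dotProduct, coeff_sum]
    refine Finset.sum_congr rfl fun b _ => ?_
    by_cases hab : F.d a b = 0
    · simp [differential, hab]
    have hle := (F.deg_lt_of_ne_zero a b hab).le
    have hiff : exponent (F.deg b - F.deg a) ≤ exponent (α - F.deg a) ↔ F.deg b ≤ α := by
      rw [exponent_le_exponent, tsub_le_iff_right, tsub_add_cancel_of_le ha]
    rw [differential, Matrix.of_apply, coeff_monomial_mul', ← exponent_sub,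
      tsub_tsub_tsub_cancel_right hle, component, mul_ite, mul_zero]
    by_cases hb : F.deg b ≤ α
    · rw [if_pos hb, if_pos (hiff.2 hb)]
    · rw [if_neg hb, if_neg (mt hiff.1 hb)]
  · rw [F.component_of_not_le ha]
    by_contra hne
    obtain ⟨b, hab, hb⟩ := exists_ne_zero_of_mulVec_ne_zero (Ne.symm hne)
    exact ha ((F.deg_lt_of_ne_zero a b hab).le.trans
      (mem_strand_iff.1 (F.component_mem_strand α v) b hb))

theorem differential_mulVec_differential_mulVec (v : F.B → MvPolynomial (Fin n) K) :
    F.differential *ᵥ F.differential *ᵥ v = 0 :=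
  F.component_injective fun α => by
    rw [component_differential_mulVec, component_differential_mulVec, Matrix.mulVec_mulVec,
      F.d_mul_d, Matrix.zero_mulVec, component_zero]

theorem exists_component_eq (A : Finset (Fin n → ℕ)) {w : (Fin n → ℕ) → F.B → K}
    (hw : ∀ α, w α ∈ strand K F.deg α) (hA : ∀ α ∉ A, w α = 0) :
    ∃ W : F.B → MvPolynomial (Fin n) K, ∀ α, F.component α W = w α := by
  refine ⟨fun b => ∑ α ∈ A, monomial (exponent (α - F.deg b)) (w α b), fun β => ?_⟩
  ext b
  by_cases hb : F.deg b ≤ β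
  · rw [F.component_of_le hb, coeff_sum, Finset.sum_eq_single β]
    · simp
    · intro α _ hne
      by_cases hαb : w α b = 0
      · simp [hαb]
      rw [coeff_monomial, if_neg]
      intro h
      have hα := mem_strand_iff.1 (hw α) b hαb
      exact hne ((tsub_left_inj hα hb).1 (exponent_injective h))
    · intro hβ
      simp [hA β hβ]
  · rw [F.component_of_not_le hb]
    exact (not_imp_comm.1 (mem_strand_iff.1 (hw β) b) hb).symm

theorem exists_finset_component_eq_zero (v : F.B → MvPolynomial (Fin n) K) :
    ∃ A : Finset (Fin n → ℕ), ∀ α ∉ A, F.component α v = 0 := by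
  classical
  refine ⟨Finset.univ.biUnion fun b => (v b).support.image fun γ : Fin n →₀ ℕ => ⇑γ + F.deg b,
    fun α hα => ?_⟩
  ext b
  by_contra h
  have hb := mem_strand_iff.1 (F.component_mem_strand α v) b h
  rw [F.component_of_le hb] at h
  refine hα (Finset.mem_biUnion.2
    ⟨b, Finset.mem_univ b, Finset.mem_image.2 ⟨exponent (α - F.deg b), ?_, ?_⟩⟩)
  · exact mem_support_iff.2 h
  · rw [coe_exponent, tsub_add_cancel_of_le hb]

theorem mem_of_coeff_differential_mulVec_base_ne_zero {v : F.B → MvPolynomial (Fin n) K}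
    {γ : Fin n →₀ ℕ} (h : coeff γ ((F.differential *ᵥ v) F.base) ≠ 0) : ⇑γ ∈ J := by
  rw [← exponent_coe γ, ← component_base, component_differential_mulVec] at h
  exact F.mem_of_mulVec_base_ne_zero _ _ (F.component_mem_strand _ _) h

theorem exists_differential_mulVec_eq {v : F.B → MvPolynomial (Fin n) K}
    (hv : F.differential *ᵥ v = 0) (hbase : ∀ γ, coeff γ (v F.base) ≠ 0 → ⇑γ ∈ J) :
    ∃ w, F.differential *ᵥ w = v := by
  have exists_component (α) : ∃ w ∈ strand K F.deg α,
      F.d *ᵥ w = F.component α v ∧ (F.component α v = 0 → w = 0) := by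
    by_cases hα : F.component α v = 0
    · exact ⟨0, zero_mem _, by simp [hα], fun _ => rfl⟩
    · obtain ⟨w, hw, hdw⟩ := F.exact α _ (F.component_mem_strand α v)
        (by rw [← component_differential_mulVec, hv, component_zero])
        fun h => hbase (exponent α) (by rwa [component_base] at h)
      exact ⟨w, hw, hdw, fun h => absurd h hα⟩
  choose w hw hdw hzero using exists_component
  obtain ⟨A, hA⟩ := F.exists_finset_component_eq_zero v
  obtain ⟨W, hW⟩ := F.exists_component_eq A hw fun α hα => hzero α (hA α hα)
  exact ⟨W, F.component_injective fun α => by rw [component_differential_mulVec, hW, hdw]⟩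

/-- The number of basis elements of homological degree `i`. -/
def rank (i : ℕ) : ℕ :=
  Fintype.card {b // F.hom b = i}

/-- A numbering of the basis elements of homological degree `i`. -/
noncomputable def basisEquiv (i : ℕ) : Fin (F.rank i) ≃ {b // F.hom b = i} :=
  (Fintype.equivFin _).symm

/-- The part of a vector in homological degree `i`. -/
noncomputable def restrict (i : ℕ) (v : F.B → MvPolynomial (Fin n) K) :
    Fin (F.rank i) → MvPolynomial (Fin n) K :=
  fun a => v (F.basisEquiv i a)

/-- The extension by zero of a vector in homological degree `i`. -/
noncomputable def extend (i : ℕ) (v : Fin (F.rank i) → MvPolynomial (Fin n) K) :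
    F.B → MvPolynomial (Fin n) K :=
  fun b => if h : F.hom b = i then v ((F.basisEquiv i).symm ⟨b, h⟩) else 0

/-- The differential from homological degree `i + 1` to homological degree `i`. -/
noncomputable def differentialAt (i : ℕ) :
    Matrix (Fin (F.rank i)) (Fin (F.rank (i + 1))) (MvPolynomial (Fin n) K) :=
  F.differential.submatrix (fun a => F.basisEquiv i a) fun b => F.basisEquiv (i + 1) b

theorem extend_of_ne {i : ℕ} {b : F.B} (hb : F.hom b ≠ i)
    (v : Fin (F.rank i) → MvPolynomial (Fin n) K) : F.extend i v b = 0 :=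
  dif_neg hb

theorem restrict_extend (i : ℕ) (v : Fin (F.rank i) → MvPolynomial (Fin n) K) :
    F.restrict i (F.extend i v) = v := by
  ext1 a
  simp [restrict, extend, (F.basisEquiv i a).2]

theorem extend_restrict {i : ℕ} {v : F.B → MvPolynomial (Fin n) K}
    (hv : ∀ b, F.hom b ≠ i → v b = 0) : F.extend i (F.restrict i v) = v := by
  ext1 b
  by_cases hb : F.hom b = i
  · simp [restrict, extend, hb]
  · rw [F.extend_of_ne hb, hv b hb]

theorem differential_eq_zero {a b : F.B} (h : F.hom b ≠ F.hom a + 1) :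
    F.differential a b = 0 := by
  rw [differential, Matrix.of_apply, not_imp_comm.1 (F.hom_eq_of_ne_zero a b) h, map_zero]

theorem restrict_differential_mulVec (i : ℕ) (w : F.B → MvPolynomial (Fin n) K) :
    F.restrict i (F.differential *ᵥ w) = F.differentialAt i *ᵥ F.restrict (i + 1) w := by
  ext1 a
  simp only [restrict, differentialAt, Matrix.mulVec, dotProduct, Matrix.submatrix_apply]
  rw [(F.basisEquiv (i + 1)).sum_comp
      (fun b : {b // F.hom b = i + 1} => F.differential (F.basisEquiv i a) b * w b),
    ← Finset.sum_subtype (Finset.univ.filter fun b => F.hom b = i + 1) (by simp)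
      (fun b => F.differential (F.basisEquiv i a) b * w b)]
  refine (Finset.sum_subset (Finset.subset_univ _) fun b _ hb => ?_).symm
  rw [F.differential_eq_zero (by simpa [(F.basisEquiv i a).2] using hb), zero_mul]

theorem differential_mulVec_extend_apply {i : ℕ} {a : F.B} (ha : F.hom a + 1 ≠ i)
    (v : Fin (F.rank i) → MvPolynomial (Fin n) K) :
    (F.differential *ᵥ F.extend i v) a = 0 := by
  by_contra hne
  obtain ⟨b, hab, hb⟩ := exists_ne_zero_of_mulVec_ne_zero hne
  have hom_b : F.hom b = i := not_imp_comm.1 (F.extend_of_ne · v) hb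
  exact hab (F.differential_eq_zero (by omega))

theorem differential_mulVec_extend (i : ℕ) (v : Fin (F.rank (i + 1)) → MvPolynomial (Fin n) K) :
    F.differential *ᵥ F.extend (i + 1) v = F.extend i (F.differentialAt i *ᵥ v) := by
  rw [← F.extend_restrict (i := i) (v := F.differential *ᵥ F.extend (i + 1) v)
    fun b hb => F.differential_mulVec_extend_apply (by omega) v,
    restrict_differential_mulVec, restrict_extend]

theorem differential_mulVec_extend_zero (v : Fin (F.rank 0) → MvPolynomial (Fin n) K) :
    F.differential *ᵥ F.extend 0 v = 0 :=
  funext fun _ => F.differential_mulVec_extend_apply (Nat.succ_ne_zero _) v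

/-- The index of the only basis element of homological degree zero. -/
noncomputable def baseIndex : Fin (F.rank 0) :=
  (F.basisEquiv 0).symm ⟨F.base, F.hom_base⟩

theorem basisEquiv_zero (a : Fin (F.rank 0)) : (F.basisEquiv 0 a : F.B) = F.base :=
  (F.hom_eq_zero_iff _).1 (F.basisEquiv 0 a).2

theorem eq_baseIndex (a : Fin (F.rank 0)) : a = F.baseIndex := by
  rw [baseIndex, Equiv.eq_symm_apply]
  exact Subtype.ext (F.basisEquiv_zero a)

/-- The augmentation from homological degree zero to the quotient ring. -/
noncomputable def augmentation (I : Ideal (MvPolynomial (Fin n) K)) :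
    (Fin (F.rank 0) → MvPolynomial (Fin n) K) →ₗ[MvPolynomial (Fin n) K]
      (MvPolynomial (Fin n) K ⧸ I) :=
  I.mkQ ∘ₗ LinearMap.proj F.baseIndex

theorem augmentation_eq_zero_iff {I : Ideal (MvPolynomial (Fin n) K)}
    (hI : ∀ p, p ∈ I ↔ ∀ γ, coeff γ p ≠ 0 → ⇑γ ∈ J)
    (v : Fin (F.rank 0) → MvPolynomial (Fin n) K) :
    F.augmentation I v = 0 ↔ ∀ γ, coeff γ (F.extend 0 v F.base) ≠ 0 → ⇑γ ∈ J := by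
  have extend_base : F.extend 0 v F.base = v F.baseIndex := by
    rw [← F.basisEquiv_zero F.baseIndex]
    exact congrFun (F.restrict_extend 0 v) _
  rw [← hI, extend_base]
  exact Submodule.Quotient.mk_eq_zero I

theorem exact_differentialAt_zero_augmentation {I : Ideal (MvPolynomial (Fin n) K)}
    (hI : ∀ p, p ∈ I ↔ ∀ γ, coeff γ p ≠ 0 → ⇑γ ∈ J) :
    Function.Exact (F.differentialAt 0).mulVecLin (F.augmentation I) := by
  intro v
  rw [F.augmentation_eq_zero_iff hI]
  constructor
  · intro h
    obtain ⟨w, hw⟩ := F.exists_differential_mulVec_eq (F.differential_mulVec_extend_zero v) h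
    exact ⟨F.restrict 1 w, by
      rw [Matrix.mulVecLin_apply, ← restrict_differential_mulVec, hw, restrict_extend]⟩
  · rintro ⟨w, rfl⟩ γ hγ
    rw [Matrix.mulVecLin_apply, ← differential_mulVec_extend] at hγ
    exact F.mem_of_coeff_differential_mulVec_base_ne_zero hγ

theorem exact_differentialAt_succ (i : ℕ) :
    Function.Exact (F.differentialAt (i + 1)).mulVecLin (F.differentialAt i).mulVecLin := by
  intro v
  simp only [Matrix.mulVecLin_apply]
  constructor
  · intro h
    obtain ⟨w, hw⟩ := F.exists_differential_mulVec_eq (v := F.extend (i + 1) v)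
      (by
        rw [differential_mulVec_extend, h]
        ext1 b
        simp [extend])
      (by simp [F.extend_of_ne (F.hom_base.trans_ne (Nat.succ_ne_zero i).symm)])
    exact ⟨F.restrict (i + 2) w, by
      rw [Matrix.mulVecLin_apply, ← restrict_differential_mulVec, hw, restrict_extend]⟩
  · rintro ⟨w, rfl⟩
    rw [Matrix.mulVecLin_apply, ← F.restrict_extend (i + 2) w, ← restrict_differential_mulVec,
      ← restrict_differential_mulVec, differential_mulVec_differential_mulVec]
    rfl

theorem constantCoeff_differential (a b : F.B) : constantCoeff (F.differential a b) = 0 := by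
  by_cases hab : F.d a b = 0
  · simp [differential, hab]
  rw [differential, Matrix.of_apply, constantCoeff_monomial, if_neg]
  intro h
  have hsub : F.deg b - F.deg a = 0 := congrArg DFunLike.coe h
  exact (F.deg_lt_of_ne_zero a b hab).not_ge (tsub_eq_zero_iff_le.1 hsub)

theorem isHomogeneous_differential {a b : F.B} (h : F.differential a b ≠ 0) :
    ∃ m, ∑ l, F.deg b l = ∑ l, F.deg a l + m ∧ (F.differential a b).IsHomogeneous m := by
  have hab : F.d a b ≠ 0 := fun hzero => h (by simp [differential, hzero])
  refine ⟨∑ l, (F.deg b - F.deg a) l, ?_, isHomogeneous_monomial _ (degree_exponent _)⟩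
  rw [← Finset.sum_add_distrib]
  exact Finset.sum_congr rfl fun l _ =>
    (add_tsub_cancel_of_le ((F.deg_lt_of_ne_zero a b hab).le l)).symm

/-- The resolution over the polynomial ring with its standard grading. -/
noncomputable def toMinimalFreeResolution {I : Ideal (MvPolynomial (Fin n) K)}
    (hI : ∀ p, p ∈ I ↔ ∀ γ, coeff γ p ≠ 0 → ⇑γ ∈ J) : MinimalFreeResolution K n I where
  rank := F.rank
  deg i a := ∑ l, F.deg (F.basisEquiv i a) l
  d := F.differentialAt
  aug := F.augmentation I
  aug_homogeneous a := by
    refine ⟨1, ?_, ?_⟩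
    · simpa [F.basisEquiv_zero, F.deg_base] using isHomogeneous_one (Fin n) K
    · rw [F.eq_baseIndex a]
      simp [augmentation]
  d_homogeneous _ _ _ h := F.isHomogeneous_differential h
  aug_surjective := (Submodule.mkQ_surjective I).comp fun p => ⟨fun _ => p, rfl⟩
  exact_zero := F.exact_differentialAt_zero_augmentation hI
  exact_succ := F.exact_differentialAt_succ
  minimal _ _ _ := F.constantCoeff_differential _ _

theorem betti_toMinimalFreeResolution {I : Ideal (MvPolynomial (Fin n) K)}
    (hI : ∀ p, p ∈ I ↔ ∀ γ, coeff γ p ≠ 0 → ⇑γ ∈ J) (i j : ℕ) :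
    (F.toMinimalFreeResolution hI).betti i j =
      F.table.countP fun q => q.1 = i ∧ ∑ l, q.2 l = j := by
  have hbij : (F.toMinimalFreeResolution hI).betti i j =
      (Finset.univ.filter fun b : {b // F.hom b = i} => ∑ l, F.deg b l = j).card :=
    Finset.card_equiv (F.basisEquiv i) fun a => by
      simp only [Finset.mem_filter, Finset.mem_univ, true_and]
      rfl
  rw [hbij, table, Multiset.countP_map, ← Fintype.card_subtype]
  change _ = (Finset.univ.filter fun b => F.hom b = i ∧ ∑ l, F.deg b l = j).card
  rw [← Fintype.card_subtype]
  exact Fintype.card_congr (Equiv.subtypeSubtypeEquivSubtypeInter (fun b => F.hom b = i)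
    fun b => ∑ l, F.deg b l = j)

end MonomialResolution

section PathColon

/-- The effect on a table of adding to an ideal, if `b` holds, a monomial with the exponents `f`
that is a nonzerodivisor modulo this ideal. -/
def koszulExtend {n : ℕ} (b : Bool) (f : Fin n → ℕ) (M : List (ℕ × (Fin n → ℕ))) :
    List (ℕ × (Fin n → ℕ)) :=
  M ++ if b then M.map (shiftEntry f) else []

theorem HasTable.koszulExtend {K : Type*} [Field K] {n : ℕ} {J : Set (Fin n → ℕ)}
    {M : List (ℕ × (Fin n → ℕ))} (hM : HasTable K J M) (b : Bool) {f : Fin n → ℕ} (v : Fin n)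
    (hv : f v ≠ 0) (hJ : b → ∀ γ, γ ∈ J ↔ γ + f ∈ J) (hMv : b → ∀ q ∈ M, q.2 v = 0) :
    HasTable K {γ | γ ∈ J ∨ (b ∧ f ≤ γ)} (koszulExtend b f M) := by
  cases b with
  | false => simpa [_root_.koszulExtend] using hM
  | true =>
    have hcone := hM.cone hM (hJ rfl) fun p hp q _ _ h => hv <| by
      have hpv := hMv rfl p hp
      rw [h, Pi.add_apply] at hpv
      exact (Nat.add_eq_zero_iff.1 hpv).2
    simpa [_root_.koszulExtend] using hcone

/-- The table of the ideal generated by `x₁x₂`, if `b` holds, and `x₂x₃`, if `c` holds. -/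
def quadricTable (b c : Bool) : List (ℕ × (Fin 6 → ℕ)) :=
  koszulExtend b ![1, 1, 0, 0, 0, 0] [(0, 0)] ++
    if c then (koszulExtend b ![1, 0, 0, 0, 0, 0] [(0, 0)]).map (shiftEntry ![0, 1, 1, 0, 0, 0])
    else []

theorem forall_fin_six {P : Fin 6 → Prop} : (∀ i, P i) ↔ P 0 ∧ P 1 ∧ P 2 ∧ P 3 ∧ P 4 ∧ P 5 := by
  simp [Fin.forall_fin_succ]

theorem le_iff_fin_six {f γ : Fin 6 → ℕ} :
    f ≤ γ ↔ f 0 ≤ γ 0 ∧ f 1 ≤ γ 1 ∧ f 2 ≤ γ 2 ∧ f 3 ≤ γ 3 ∧ f 4 ≤ γ 4 ∧ f 5 ≤ γ 5 :=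
  forall_fin_six

theorem hasTable_quadricTable (K : Type*) [Field K] (b c : Bool) :
    HasTable K {γ : Fin 6 → ℕ | (b ∧ 0 < γ 0 ∧ 0 < γ 1) ∨ (c ∧ 0 < γ 1 ∧ 0 < γ 2)}
      (quadricTable b c) := by
  have hunit : HasTable K (∅ : Set (Fin 6 → ℕ)) ([(0, 0)] : List (ℕ × (Fin 6 → ℕ))) :=
    hasTable_empty
  have hfirst := hunit.koszulExtend b (f := ![1, 1, 0, 0, 0, 0]) 0 (by simp) (by simp) (by simp)
  have hcolon := hunit.koszulExtend b (f := ![1, 0, 0, 0, 0, 0]) 0 (by simp) (by simp) (by simp)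
  cases c with
  | false =>
    convert hfirst using 1
    · ext γ
      simp [le_iff_fin_six, Nat.pos_iff_ne_zero, Nat.one_le_iff_ne_zero]
    · simp [quadricTable]
  | true =>
    convert hfirst.cone hcolon (f := ![0, 1, 1, 0, 0, 0]) (fun γ => ?_) ?_ using 1
    · ext γ
      simp [le_iff_fin_six, Nat.pos_iff_ne_zero, Nat.one_le_iff_ne_zero]
    · simp [quadricTable]
    · simp [le_iff_fin_six, -Matrix.add_cons]
    · clear * -
      decide +revert

/-- The exponents of the colon ideal of the generators of a power of the path ideal that precede a
given one.  It depends only on which of the last four edges divide this generator, which is what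
`p`, `q`, `r` and `s` record. -/
def colonSet (p q r s : Bool) : Set (Fin 6 → ℕ) :=
  {γ | (p ∧ 0 < γ 0) ∨ (q ∧ 0 < γ 1) ∨ (r ∧ 0 < γ 2) ∨ (s ∧ 0 < γ 3) ∨
    ((r ∨ s) ∧ 0 < γ 0 ∧ 0 < γ 1) ∨ (s ∧ 0 < γ 1 ∧ 0 < γ 2)}

/-- The table of the ideal with the exponents `colonSet p q r s`. -/
def colonTable (p q r s : Bool) : List (ℕ × (Fin 6 → ℕ)) :=
  koszulExtend p ![1, 0, 0, 0, 0, 0] <| koszulExtend q ![0, 1, 0, 0, 0, 0] <|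
    koszulExtend r ![0, 0, 1, 0, 0, 0] <| koszulExtend s ![0, 0, 0, 1, 0, 0] <|
      quadricTable ((r || s) && !p && !q) (s && !q && !r)

theorem hasTable_colonTable (K : Type*) [Field K] (p q r s : Bool) :
    HasTable K (colonSet p q r s) (colonTable p q r s) := by
  have hquadric := hasTable_quadricTable K ((r || s) && !p && !q) (s && !q && !r)
  have hs := hquadric.koszulExtend s (f := ![0, 0, 0, 1, 0, 0]) 3 (by simp)
    (by simp [-Matrix.add_cons]) (by clear * -; decide +revert)
  have hr := hs.koszulExtend r (f := ![0, 0, 1, 0, 0, 0]) 2 (by simp)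
    (by simp +contextual [le_iff_fin_six, -Matrix.add_cons]) (by clear * -; decide +revert)
  have hq := hr.koszulExtend q (f := ![0, 1, 0, 0, 0, 0]) 1 (by simp)
    (by simp +contextual [le_iff_fin_six, -Matrix.add_cons]) (by clear * -; decide +revert)
  have hp := hq.koszulExtend p (f := ![1, 0, 0, 0, 0, 0]) 0 (by simp)
    (by simp +contextual [le_iff_fin_six, -Matrix.add_cons]) (by clear * -; decide +revert)
  convert hp using 1
  · ext γ
    cases p <;> cases q <;> cases r <;> cases s <;>
      simp [colonSet, le_iff_fin_six] <;> omega
  · rfl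

theorem colonTable_sum (p q r s : Bool) :
    ∀ t ∈ colonTable p q r s, ∑ l, t.2 l = t.1 ∨ ∑ l, t.2 l = t.1 + 1 := by
  decide +revert

theorem le_of_mem_colonTable_of_sum_eq (p q r s : Bool) :
    ∀ t ∈ colonTable p q r s, ∑ l, t.2 l = t.1 →
      ∀ l, t.2 l ≤ ![p.toNat, q.toNat, r.toNat, s.toNat, 0, 0] l := by
  decide +revert

theorem apply_eq_zero_of_mem_colonTable (p q r s : Bool) :
    ∀ t ∈ colonTable p q r s, t.2 4 = 0 ∧ t.2 5 = 0 := by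
  decide +revert

theorem quadric_of_mem_colonTable_of_sum_eq_succ (p q r s : Bool) :
    ∀ t ∈ colonTable p q r s, ∑ l, t.2 l = t.1 + 1 →
      (p = false ∧ q = false ∧ t.2 0 = 1 ∧ t.2 1 = 1 ∧ t.2 2 ≤ r.toNat ∧ t.2 3 ≤ s.toNat) ∨
        (q = false ∧ r = false ∧ t.2 1 = 1 ∧ t.2 2 = 1) := by
  decide +revert

end PathColon

section Exchange

theorem exists_add_single_eq {ι : Type*} [DecidableEq ι] {a : ι → ℕ} {i : ι} (hi : a i ≠ 0) :
    ∃ b : ι → ℕ, b + Pi.single i 1 = a :=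
  ⟨a - Pi.single i 1, tsub_add_cancel_of_le fun j => by
    rcases eq_or_ne j i with rfl | hj
    · simpa [Nat.one_le_iff_ne_zero] using hi
    · simp [hj]⟩

theorem sum_add_single {ι : Type*} [Fintype ι] [DecidableEq ι] (b : ι → ℕ) (i : ι) :
    ∑ j, (b + Pi.single i 1 : ι → ℕ) j = ∑ j, b j + 1 := by
  simp [Finset.sum_add_distrib]

theorem toLex_add_single_lt {m : ℕ} (b : Fin m → ℕ) {i j : Fin m} (hij : i < j) :
    toLex (b + Pi.single j 1) < toLex (b + Pi.single i 1) :=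
  ⟨i, fun l hl => by simp [hl.ne, (hl.trans hij).ne], by simp [hij.ne]⟩

end Exchange

section PathExponent

/-- The exponent vector of the product of the edges `x₁x₂, …, x₅x₆` with the given exponents. -/
def pathExponent : (Fin 5 → ℕ) →+ (Fin 6 → ℕ) where
  toFun a := ![a 0, a 0 + a 1, a 1 + a 2, a 2 + a 3, a 3 + a 4, a 4]
  map_zero' := by decide
  map_add' a b := by
    simp only [Pi.add_apply, Matrix.cons_add_cons, Matrix.empty_add_empty]
    congr 2 <;> ring_nf

theorem pathExponent_apply (a : Fin 5 → ℕ) :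
    pathExponent a = ![a 0, a 0 + a 1, a 1 + a 2, a 2 + a 3, a 3 + a 4, a 4] :=
  rfl

theorem sum_pathExponent (a : Fin 5 → ℕ) : ∑ l, pathExponent a l = 2 * ∑ i, a i := by
  simp only [pathExponent_apply, Fin.sum_univ_six, Fin.sum_univ_five, Matrix.cons_val]
  ring

theorem exists_lex_lt_of_exchange {a : Fin 5 → ℕ} {γ : Fin 6 → ℕ} {i j : Fin 5} (hij : i < j)
    (hj : 0 < a j)
    (hγ : pathExponent (Pi.single i 1) ≤ γ + pathExponent (Pi.single j 1)) :
    ∃ b : Fin 5 → ℕ, ∑ l, b l = ∑ l, a l ∧ toLex a < toLex b ∧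
      pathExponent b ≤ γ + pathExponent a := by
  obtain ⟨b, rfl⟩ := exists_add_single_eq hj.ne'
  refine ⟨b + Pi.single i 1, by rw [sum_add_single, sum_add_single],
    toLex_add_single_lt b hij, ?_⟩
  rw [map_add, map_add, add_left_comm]
  exact add_le_add_right hγ _

theorem exists_lex_lt_of_mem_colonSet {a : Fin 5 → ℕ} {γ : Fin 6 → ℕ}
    (hγ : γ ∈ colonSet (0 < a 1) (0 < a 2) (0 < a 3) (0 < a 4)) :
    ∃ b : Fin 5 → ℕ, ∑ i, b i = ∑ i, a i ∧ toLex a < toLex b ∧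
      pathExponent b ≤ γ + pathExponent a := by
  obtain ⟨i, j, hij, hj, hle⟩ : ∃ i j : Fin 5, i < j ∧ 0 < a j ∧
      pathExponent (Pi.single i 1) ≤ γ + pathExponent (Pi.single j 1) := by
    simp only [colonSet, Set.mem_ofPred_eq, decide_eq_true_eq] at hγ
    simp only [pathExponent_apply, le_iff_fin_six, Pi.add_apply, Matrix.cons_val]
    rcases hγ with ⟨ha, h⟩ | ⟨ha, h⟩ | ⟨ha, h⟩ | ⟨ha, h⟩ | ⟨ha | ha, h⟩ | ⟨ha, h⟩
    · exact ⟨0, 1, by decide, ha, by simp; omega⟩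
    · exact ⟨1, 2, by decide, ha, by simp; omega⟩
    · exact ⟨2, 3, by decide, ha, by simp; omega⟩
    · exact ⟨3, 4, by decide, ha, by simp; omega⟩
    · exact ⟨0, 3, by decide, ha, by simp; omega⟩
    · exact ⟨0, 4, by decide, ha, by simp; omega⟩
    · exact ⟨1, 4, by decide, ha, by simp; omega⟩
  exact exists_lex_lt_of_exchange hij hj hle

theorem mem_colonSet_of_lex_lt {a b : Fin 5 → ℕ} {γ : Fin 6 → ℕ}
    (hsum : ∑ i, b i = ∑ i, a i) (hlt : toLex a < toLex b)
    (hγ : pathExponent b ≤ γ + pathExponent a) :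
    γ ∈ colonSet (0 < a 1) (0 < a 2) (0 < a 3) (0 < a 4) := by
  obtain ⟨i, heq, hi⟩ := hlt
  simp only [Pi.toLex_apply] at heq hi
  simp only [Fin.sum_univ_five] at hsum
  simp only [le_iff_fin_six, Pi.add_apply, pathExponent_apply, Matrix.cons_val] at hγ
  simp only [colonSet, Set.mem_ofPred_eq, decide_eq_true_eq]
  have heq0 := heq 0
  have heq1 := heq 1
  have heq2 := heq 2
  have heq3 := heq 3
  fin_cases i <;> simp at * <;> omega

theorem mem_colonSet_iff {k : ℕ} {a : Fin 5 → ℕ} (ha : ∑ i, a i = k)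
    (γ : Fin 6 → ℕ) :
    γ ∈ colonSet (0 < a 1) (0 < a 2) (0 < a 3) (0 < a 4) ↔
      ∃ b ∈ Finset.Nat.antidiagonalTuple 5 k, toLex a < toLex b ∧
        pathExponent b ≤ γ + pathExponent a := by
  simp only [Finset.Nat.mem_antidiagonalTuple, ← ha]
  exact ⟨exists_lex_lt_of_mem_colonSet, fun ⟨_, hsum, hlt, hb⟩ =>
    mem_colonSet_of_lex_lt hsum hlt hb⟩

/-- The table of the colon ideal at the generator with the exponents `a`. -/
def pathColonTable (a : Fin 5 → ℕ) : List (ℕ × (Fin 6 → ℕ)) :=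
  colonTable (0 < a 1) (0 < a 2) (0 < a 3) (0 < a 4)

theorem toNat_decide_pos (m : ℕ) : (decide (0 < m)).toNat = min m 1 := by
  cases m <;> simp

/-- By comparison of degrees, an equality would have to be between a quadric entry of one colon
ideal and a linear entry of another. -/
theorem pathColonTable_disjoint {a b : Fin 5 → ℕ} {t u : ℕ × (Fin 6 → ℕ)}
    (hab : ∑ i, a i = ∑ i, b i) (ht : t ∈ pathColonTable b) (hu : u ∈ pathColonTable a)
    (hhom : t.1 + 1 = u.1) : t.2 + pathExponent b ≠ u.2 + pathExponent a := by
  intro h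
  have hdeg : ∑ l, t.2 l = ∑ l, u.2 l := by
    have := congrArg (fun γ : Fin 6 → ℕ => ∑ l, γ l) h
    simpa [Finset.sum_add_distrib, sum_pathExponent, hab] using this
  have ht_sum := colonTable_sum _ _ _ _ t ht
  have hu_sum := colonTable_sum _ _ _ _ u hu
  have hquadric := quadric_of_mem_colonTable_of_sum_eq_succ _ _ _ _ t ht (by omega)
  have hlinear := le_of_mem_colonTable_of_sum_eq _ _ _ _ u hu (by omega)
  have ht_zero := apply_eq_zero_of_mem_colonTable _ _ _ _ t ht
  simp only [toNat_decide_pos, decide_eq_false_iff_not] at hquadric hlinear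
  simp only [funext_iff, forall_fin_six, Pi.add_apply, pathExponent_apply, Matrix.cons_val]
    at h hlinear
  rw [Fin.sum_univ_five, Fin.sum_univ_five] at hab
  omega

/-- The exponents of the monomials in the `k`-th power of the path ideal. -/
def pathPowerSet (k : ℕ) : Set (Fin 6 → ℕ) :=
  {γ | ∃ a ∈ Finset.Nat.antidiagonalTuple 5 k, pathExponent a ≤ γ}

/-- The table of the minimal free resolution of the quotient by the `k`-th power of the path
ideal. -/
def pathPowerTable (k : ℕ) : Multiset (ℕ × (Fin 6 → ℕ)) :=
  {(0, 0)} + ∑ a ∈ Finset.Nat.antidiagonalTuple 5 k,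
    Multiset.map (shiftEntry (pathExponent a)) (pathColonTable a)

theorem pathExponent_ne_zero {a : Fin 5 → ℕ} (ha : ∑ i, a i ≠ 0) : pathExponent a ≠ 0 := by
  intro h
  have hsum := sum_pathExponent a
  simp only [h, Pi.zero_apply, Finset.sum_const_zero] at hsum
  omega

theorem hasTable_pathPowerSet (K : Type*) [Field K] {k : ℕ} (hk : k ≠ 0) :
    HasTable K (pathPowerSet k) (pathPowerTable k) :=
  hasTable_of_colon toLex.injective (Finset.Nat.antidiagonalTuple 5 k)
    (fun _ ha => pathExponent_ne_zero (by rwa [Finset.Nat.mem_antidiagonalTuple.1 ha]))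
    (fun _ _ => hasTable_colonTable K _ _ _ _)
    (fun _ ha => mem_colonSet_iff (Finset.Nat.mem_antidiagonalTuple.1 ha))
    (fun _ ha _ hb _ _ hu _ ht => pathColonTable_disjoint
      ((Finset.Nat.mem_antidiagonalTuple.1 ha).trans (Finset.Nat.mem_antidiagonalTuple.1 hb).symm)
      ht hu)

end PathExponent

section SpanMonomial

variable {K : Type*} [Field K] {ι : Type*} [Fintype ι] [DecidableEq ι] {n : ℕ}

theorem monomial_exponent_add (γ δ : Fin n → ℕ) :
    monomial (exponent (γ + δ)) (1 : K) =
      monomial (exponent γ) 1 * monomial (exponent δ) 1 := by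
  rw [monomial_mul, one_mul]
  exact congrArg (monomial · 1) (Finsupp.ext fun _ => rfl)

theorem span_monomial_pow (e : (ι → ℕ) →+ (Fin n → ℕ)) (k : ℕ) :
    Ideal.span (Set.range fun i => monomial (exponent (e (Pi.single i 1))) (1 : K)) ^ k =
      Ideal.span ((fun a => monomial (exponent (e a)) (1 : K)) '' {a | ∑ i, a i = k}) := by
  induction k with
  | zero =>
    have hone : monomial (exponent (e 0)) (1 : K) = 1 := by
      rw [map_zero, show exponent (0 : Fin n → ℕ) = 0 from Finsupp.ext fun _ => rfl]
      rfl
    rw [pow_zero, Ideal.one_eq_top, eq_comm, Ideal.eq_top_iff_one]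
    exact Ideal.subset_span ⟨0, by simp, hone⟩
  | succ k ih =>
    rw [pow_succ, ih, Ideal.span_mul_span']
    congr 1
    ext p
    simp only [Set.mem_mul, Set.exists_range_iff, Set.mem_image]
    constructor
    · rintro ⟨_, ⟨a, ha, rfl⟩, i, rfl⟩
      exact ⟨a + Pi.single i 1, (sum_add_single a i).trans (congrArg (· + 1) ha), by
        rw [map_add, monomial_exponent_add]⟩
    · rintro ⟨a, ha, rfl⟩
      obtain ⟨i, -, hi⟩ := Finset.exists_ne_zero_of_sum_ne_zero (ha.trans_ne k.succ_ne_zero)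
      obtain ⟨b, rfl⟩ := exists_add_single_eq hi
      exact ⟨_, ⟨b, Nat.succ_injective ((sum_add_single b i).symm.trans ha), rfl⟩, i, by
        rw [map_add, monomial_exponent_add]⟩

end SpanMonomial

section PathIdeal

variable (K : Type*) [Field K] (k : ℕ)

theorem monomial_pathExponent_single (i : Fin 5) :
    monomial (exponent (pathExponent (Pi.single i 1))) (1 : K) = X i.castSucc * X i.succ := by
  rw [X, X, monomial_mul, one_mul]
  refine congrArg (monomial · 1) (Finsupp.ext fun j => ?_)
  rw [coe_exponent]
  fin_cases i <;> fin_cases j <;> simp [pathExponent_apply]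

theorem pathIdeal_eq_span : pathIdeal K =
    Ideal.span (Set.range fun i => monomial (exponent (pathExponent (Pi.single i 1))) 1) := by
  simp only [monomial_pathExponent_single, pathIdeal]
  congr 1
  ext p
  simp [Fin.exists_fin_succ, eq_comm]

theorem mem_pathIdeal_pow_iff (p : MvPolynomial (Fin 6) K) :
    p ∈ pathIdeal K ^ k ↔ ∀ γ, coeff γ p ≠ 0 → ⇑γ ∈ pathPowerSet k := by
  rw [pathIdeal_eq_span, span_monomial_pow,
    ← Set.image_image (fun γ => monomial γ (1 : K)) (fun a => exponent (pathExponent a)),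
    mem_ideal_span_monomial_image]
  simp only [mem_support_iff, Set.exists_mem_image, pathPowerSet,
    Finset.Nat.mem_antidiagonalTuple]
  rfl

theorem isHomogeneous_pathIdeal_pow :
    (pathIdeal K ^ k).IsHomogeneous (homogeneousSubmodule (Fin 6) K) := by
  rw [pathIdeal_eq_span, span_monomial_pow]
  refine Ideal.homogeneous_span _ _ ?_
  rintro _ ⟨a, -, rfl⟩
  exact ⟨_, isHomogeneous_monomial _ rfl⟩

end PathIdeal

section Counting

variable {M : Type*} [AddCommMonoid M]

theorem sum_fin_succ_arrow {α : Type*} [Fintype α] {m : ℕ} (f : (Fin (m + 1) → α) → M) :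
    ∑ s, f s = ∑ x, ∑ s : Fin m → α, f (Fin.cons x s) := by
  rw [← (Fin.consEquiv fun _ => α).sum_comp, Fintype.sum_prod_type]
  rfl

theorem sum_antidiagonalTuple_succ {m k : ℕ} (f : (Fin (m + 1) → ℕ) → M) :
    ∑ t ∈ Finset.Nat.antidiagonalTuple (m + 1) k, f t =
      ∑ x ∈ Finset.HasAntidiagonal.antidiagonal k,
        ∑ t ∈ Finset.Nat.antidiagonalTuple m x.2, f (Fin.cons x.1 t) := by
  change (List.map f (List.Nat.antidiagonalTuple (m + 1) k)).sum =
    (List.map (fun x : ℕ × ℕ => (List.map (fun t => f (Fin.cons x.1 t))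
      (List.Nat.antidiagonalTuple m x.2)).sum) (List.Nat.antidiagonal k)).sum
  simp [List.Nat.antidiagonalTuple, List.flatMap, List.map_flatten, List.sum_flatten,
    Function.comp_def]

theorem sum_antidiagonalTuple_comp_perm {m k : ℕ} (e : Equiv.Perm (Fin m)) (f : (Fin m → ℕ) → M) :
    ∑ t ∈ Finset.Nat.antidiagonalTuple m k, f (t ∘ e) =
      ∑ t ∈ Finset.Nat.antidiagonalTuple m k, f t := by
  refine Finset.sum_equiv (e.symm.arrowCongr (Equiv.refl ℕ)) (fun t => ?_) fun t _ => rfl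
  simp only [Finset.Nat.mem_antidiagonalTuple, Equiv.arrowCongr_apply, Equiv.symm_symm,
    Equiv.coe_refl, Function.comp_apply, id_eq, Equiv.sum_comp e t]

theorem sum_antidiagonal_choose_snd (k p : ℕ) :
    ∑ x ∈ Finset.HasAntidiagonal.antidiagonal k, x.2.choose p = (k + 1).choose (p + 1) := by
  induction k with
  | zero => simp [Nat.choose_succ_succ']
  | succ k ih =>
    rw [Finset.Nat.sum_antidiagonal_succ, ih, Nat.choose_succ_succ' (k + 1)]

theorem sum_antidiagonal_choose_smul (k p : ℕ) (u : Bool → M) :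
    ∑ x ∈ Finset.HasAntidiagonal.antidiagonal k, x.2.choose p • u (0 < x.1) =
      k.choose (p + 1) • u true + k.choose p • u false := by
  cases k with
  | zero => simp
  | succ k =>
    rw [Finset.Nat.sum_antidiagonal_succ]
    simp [← Finset.sum_smul, sum_antidiagonal_choose_snd, add_comm]

theorem sum_antidiagonalTuple_castSucc_pos {m k : ℕ} (g : (Fin m → Bool) → M) :
    ∑ t ∈ Finset.Nat.antidiagonalTuple (m + 1) k, g (fun i => 0 < t i.castSucc) =
      ∑ s, k.choose (∑ i, (s i).toNat) • g s := by
  induction m generalizing k with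
  | zero =>
    rw [Fintype.sum_subsingleton _ (fun i : Fin 0 => i.elim0)]
    simpa using congrArg g (Subsingleton.elim _ _)
  | succ m ih =>
    have hinner (x : ℕ × ℕ) : ∑ t ∈ Finset.Nat.antidiagonalTuple (m + 1) x.2,
        g (fun i => 0 < (Fin.cons x.1 t : Fin (m + 2) → ℕ) i.castSucc) =
          ∑ s, x.2.choose (∑ i, (s i).toNat) • g (Fin.cons (decide (0 < x.1)) s) := by
      rw [← ih fun s => g (Fin.cons (decide (0 < x.1)) s)]
      refine Finset.sum_congr rfl fun t _ => congrArg g (funext fun i => ?_)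
      cases i using Fin.cases <;> simp
    simp only [sum_antidiagonalTuple_succ, hinner]
    rw [Finset.sum_comm, sum_fin_succ_arrow, Fintype.sum_bool, ← Finset.sum_add_distrib]
    refine Finset.sum_congr rfl fun s _ => ?_
    rw [sum_antidiagonal_choose_smul k _ fun b => g (Fin.cons b s)]
    simp [Fin.sum_univ_succ, add_comm]

theorem sum_antidiagonalTuple_succ_pos {m k : ℕ} (g : (Fin m → Bool) → M) :
    ∑ t ∈ Finset.Nat.antidiagonalTuple (m + 1) k, g (fun i => 0 < t i.succ) =
      ∑ s, k.choose (∑ i, (s i).toNat) • g s := by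
  rw [← sum_antidiagonalTuple_castSucc_pos,
    ← sum_antidiagonalTuple_comp_perm (finRotate (m + 1)) fun t => g fun i => 0 < t i.castSucc]
  simp

theorem sum_antidiagonalTuple_five_pos (k : ℕ) (g : Bool → Bool → Bool → Bool → M) :
    ∑ a ∈ Finset.Nat.antidiagonalTuple 5 k, g (0 < a 1) (0 < a 2) (0 < a 3) (0 < a 4) =
      ∑ p, ∑ q, ∑ r, ∑ s, k.choose (p.toNat + q.toNat + r.toNat + s.toNat) • g p q r s := by
  refine (sum_antidiagonalTuple_succ_pos fun s : Fin 4 → Bool => g (s 0) (s 1) (s 2) (s 3)).trans ?_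
  simp only [Fin.sum_univ_four, sum_fin_succ_arrow, Fintype.sum_unique]
  rfl

end Counting

section Betti

theorem fst_lt_five_of_mem_colonTable (p q r s : Bool) : ∀ t ∈ colonTable p q r s, t.1 < 5 := by
  decide +revert

theorem countP_colonTable_eq_zero (p q r s : Bool) {i : ℕ} (hi : 5 ≤ i) (j : ℕ) :
    (colonTable p q r s).countP (fun t => t.1 = i ∧ ∑ l, t.2 l = j) = 0 := by
  simp only [List.countP_eq_zero, decide_eq_true_eq]
  rintro t ht ⟨rfl, -⟩
  exact (fst_lt_five_of_mem_colonTable p q r s t ht).not_ge hi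

theorem countP_colonTable_row_zero (p q r s : Bool) (i : ℕ) :
    (colonTable p q r s).countP (fun t => t.1 = i ∧ ∑ l, t.2 l = i) =
      (p.toNat + q.toNat + r.toNat + s.toNat).choose i := by
  obtain hi | hi := lt_or_ge i 5
  · revert i
    decide +revert
  · have hcount : p.toNat + q.toNat + r.toNat + s.toNat < 5 := by
      clear * -
      decide +revert
    rw [countP_colonTable_eq_zero p q r s hi, Nat.choose_eq_zero_of_lt (hcount.trans_le hi)]

/-- The number of entries of `colonTable p q r s` in column `i` and row one. -/
def quadricCount (p q r s : Bool) (i : ℕ) : ℕ :=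
  if s && !q && !r then
    if p then [0, 1, 2, 1].getD i 0 else [0, 2, 3, 1].getD i 0
  else if (r || s) && !p && !q then
    if r && s then [0, 1, 2, 1].getD i 0 else [0, 1, 1].getD i 0
  else 0

theorem quadricCount_eq_zero (p q r s : Bool) {i : ℕ} (hi : 4 ≤ i) :
    quadricCount p q r s i = 0 := by
  obtain ⟨m, rfl⟩ := Nat.exists_eq_add_of_le' hi
  simp [quadricCount]

theorem countP_colonTable_row_one (p q r s : Bool) (i : ℕ) :
    (colonTable p q r s).countP (fun t => t.1 = i ∧ ∑ l, t.2 l = i + 1) =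
      quadricCount p q r s i := by
  obtain hi | hi := lt_or_ge i 5
  · revert i
    decide +revert
  · rw [countP_colonTable_eq_zero p q r s hi, quadricCount_eq_zero p q r s (by omega)]

theorem countP_colonTable (p q r s : Bool) (i j c : ℕ) :
    (colonTable p q r s).countP (fun t => t.1 = i ∧ ∑ l, t.2 l + c = j) =
      if j = i + c then (p.toNat + q.toNat + r.toNat + s.toNat).choose i
      else if j = i + 1 + c then quadricCount p q r s i else 0 := by
  split_ifs with hzero hone
  · simp only [hzero, add_left_inj, countP_colonTable_row_zero]
  · simp only [hone, add_left_inj, countP_colonTable_row_one]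
  · simp only [List.countP_eq_zero, decide_eq_true_eq]
    rintro t ht ⟨rfl, rfl⟩
    have := colonTable_sum p q r s t ht
    omega

theorem sum_choose_mul_choose (k i : ℕ) :
    ∑ p : Bool, ∑ q : Bool, ∑ r : Bool, ∑ s : Bool,
      k.choose (p.toNat + q.toNat + r.toNat + s.toNat) *
        (p.toNat + q.toNat + r.toNat + s.toNat).choose i = pathRow₁ k (i + 1) := by
  simp only [Fintype.sum_bool, Bool.toNat_true, Bool.toNat_false]
  match i with
  | 0 | 1 | 2 | 3 | 4 => simp [pathRow₁, Nat.choose_succ_succ'] <;> ring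
  | m + 5 => simp [pathRow₁, Nat.choose_eq_zero_of_lt]

theorem sq_eq_two_mul_choose_two_add (k : ℕ) : k ^ 2 = 2 * k.choose 2 + k := by
  induction k with
  | zero => rfl
  | succ k ih =>
    rw [Nat.choose_succ_succ' k 1, Nat.choose_one_right]
    linarith

theorem sum_choose_mul_quadricCount (k i : ℕ) :
    ∑ p : Bool, ∑ q : Bool, ∑ r : Bool, ∑ s : Bool,
      k.choose (p.toNat + q.toNat + r.toNat + s.toNat) * quadricCount p q r s i =
        pathRow₂ k (i + 1) := by
  simp only [Fintype.sum_bool, Bool.toNat_true, Bool.toNat_false]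
  have hk2 := sq_eq_two_mul_choose_two_add k
  match i with
  | 0 | 1 | 2 | 3 => simp [pathRow₂, quadricCount] <;> nlinarith
  | m + 4 => simp [pathRow₂, quadricCount]

theorem countP_sum {α ι : Type*} (P : α → Prop) [DecidablePred P] (s : Finset ι)
    (T : ι → Multiset α) : (∑ a ∈ s, T a).countP P = ∑ a ∈ s, (T a).countP P :=
  map_sum (Multiset.countPAddMonoidHom P) T s

theorem countP_pathPowerTable_eq_sum (k i j : ℕ) :
    (pathPowerTable k).countP (fun t => t.1 = i ∧ ∑ l, t.2 l = j) =
      (if i = 0 ∧ j = 0 then 1 else 0) +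
        ∑ p, ∑ q, ∑ r, ∑ s, k.choose (p.toNat + q.toNat + r.toNat + s.toNat) *
          (colonTable p q r s).countP fun t => t.1 + 1 = i ∧ ∑ l, t.2 l + 2 * k = j := by
  simp only [pathPowerTable, Multiset.countP_add, countP_sum, ← smul_eq_mul]
  rw [← sum_antidiagonalTuple_five_pos]
  congr 1
  · rw [← Multiset.cons_zero, Multiset.countP_cons]
    simp [eq_comm]
  · refine Finset.sum_congr rfl fun a ha => ?_
    rw [Finset.Nat.mem_antidiagonalTuple] at ha
    simp only [Multiset.map_coe, Multiset.coe_countP, List.countP_map, pathColonTable]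
    refine List.countP_congr fun t _ => ?_
    simp only [Function.comp_apply, shiftEntry, Pi.add_apply, Finset.sum_add_distrib,
      sum_pathExponent, ha, smul_eq_mul]

theorem countP_pathPowerTable (k i j : ℕ) :
    (pathPowerTable k).countP (fun t => t.1 = i ∧ ∑ l, t.2 l = j) = pathDiagram k i j := by
  rw [countP_pathPowerTable_eq_sum, pathDiagram]
  cases i with
  | zero => simp [pathRow₁, pathRow₂]
  | succ i =>
    have hne : ¬(i + 1 = 0 ∧ j = 0) := by simp
    simp only [if_neg hne, zero_add, add_left_inj, countP_colonTable,
      show j + 1 = i + 1 + 2 * k ↔ j = i + 2 * k by omega]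
    split_ifs
    · exact sum_choose_mul_choose k i
    · exact sum_choose_mul_quadricCount k i
    · simp only [mul_zero, Finset.sum_const_zero]

theorem betti_pathIdeal_pow {K : Type*} [Field K] {k : ℕ} (hk : k ≠ 0)
    (F : MinimalFreeResolution K 6 (pathIdeal K ^ k)) (i j : ℕ) :
    F.betti i j = pathDiagram k i j := by
  obtain ⟨G, hG⟩ := hasTable_pathPowerSet K hk
  rw [F.betti_eq (G.toMinimalFreeResolution (mem_pathIdeal_pow_iff K k))
    (isHomogeneous_pathIdeal_pow K k), G.betti_toMinimalFreeResolution, hG,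
    countP_pathPowerTable]

end Betti

section Position

/-- The positions `(i, j)` of the nonzero entries of the Betti diagram of the `k`-th power of the
path ideal. -/
def pathPosition (k : ℕ) : Fin 9 → ℕ × ℕ :=
  ![(0, 0), (1, 2 * k), (2, 2 * k + 1), (2, 2 * k + 2), (3, 2 * k + 2), (3, 2 * k + 3),
    (4, 2 * k + 3), (4, 2 * k + 4), (5, 2 * k + 4)]

theorem mem_range_pathPosition {k i j : ℕ} :
    (i, j) ∈ Set.range (pathPosition k) ↔ (i = 0 ∧ j = 0) ∨ (i = 1 ∧ j = 2 * k) ∨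
      (i = 2 ∧ (j = 2 * k + 1 ∨ j = 2 * k + 2)) ∨ (i = 3 ∧ (j = 2 * k + 2 ∨ j = 2 * k + 3)) ∨
      (i = 4 ∧ (j = 2 * k + 3 ∨ j = 2 * k + 4)) ∨ (i = 5 ∧ j = 2 * k + 4) := by
  simp only [pathPosition, Matrix.range_cons, Matrix.range_empty, Set.mem_union,
    Set.mem_singleton_iff, Prod.mk.injEq, Set.mem_empty_iff_false, or_false]
  grind

theorem mem_range_pathPosition_of_pathDiagram_ne_zero {k i j : ℕ} (h : pathDiagram k i j ≠ 0) :
    (i, j) ∈ Set.range (pathPosition k) := by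
  rw [mem_range_pathPosition]
  unfold pathDiagram pathRow₁ pathRow₂ at h
  split_ifs at h
  · omega
  · split at h <;> omega
  · split at h <;> omega
  · exact absurd rfl h

theorem forall_getElem?_cons {α : Type*} {P : ℕ → α → Prop} {a : α} {l : List α} :
    (∀ i x, (a :: l)[i]? = some x → P i x) ↔ P 0 a ∧ ∀ i x, l[i]? = some x → P (i + 1) x := by
  refine ⟨fun h => ⟨h 0 a rfl, fun i => h (i + 1)⟩, fun h i x hx => ?_⟩
  cases i with
  | zero =>
    obtain rfl : a = x := by simpa using hx
    exact h.1
  | succ i => exact h.2 i x hx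

theorem mem_range_pathPosition_of_translatedSequence (k : ℕ) (s : Fin 8) :
    ∀ i j, (translatedSequence k s)[i]? = some j → (i, j) ∈ Set.range (pathPosition k) := by
  simp only [mem_range_pathPosition]
  fin_cases s <;> simp [translatedSequence, forall_getElem?_cons]

theorem mem_range_translatedSequence_of_forall_mem_range_pathPosition {k : ℕ} {d : List ℕ}
    (hd : IsDegreeSequence d) (hlen : 3 < d.length)
    (h : ∀ i j, d[i]? = some j → (i, j) ∈ Set.range (pathPosition k)) :
    d ∈ Set.range (translatedSequence k) := by
  have hlt := hd.2
  simp only [translatedSequence, Matrix.range_cons, Matrix.range_empty, Set.mem_union,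
    Set.mem_singleton_iff, Set.mem_empty_iff_false]
  simp only [mem_range_pathPosition] at h
  match d with
  | [] | [_] | [_, _] | [_, _, _] => exact absurd hlen (by simp)
  | _ :: _ :: _ :: _ :: _ :: _ :: a :: _ => exact absurd (h 6 a rfl) (by omega)
  | [_, _, _, _] | [_, _, _, _, _] | [_, _, _, _, _, _] =>
    simp only [forall_getElem?_cons, List.getElem?_nil, true_and, zero_ne_one, false_and,
      OfNat.zero_ne_ofNat, or_self, or_false, false_or, Nat.add_eq_zero_iff,
      one_ne_zero, and_false, Nat.add_eq_right, Nat.reduceEqDiff, reduceCtorEq, false_imp_iff,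
      implies_true, and_true, List.pairwise_cons, List.mem_cons, List.not_mem_nil, forall_eq_or_imp,
      forall_eq, List.Pairwise.nil, List.cons.injEq] at h hlt ⊢
    omega

end Position

section PureDiagram

theorem pureDiagram_pos {d : List ℕ} (hd : IsDegreeSequence d) {i j : ℕ} (h : d[i]? = some j) :
    0 < pureDiagram d i j := by
  obtain ⟨hne, hlt⟩ := hd
  rw [pureDiagram, if_pos h]
  refine div_pos (List.prod_pos ?_) (List.prod_pos ?_)
  · obtain ⟨a, d, rfl⟩ := List.exists_cons_of_ne_nil hne
    simpa using (List.pairwise_cons.1 hlt).1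
  · have hj (l : ℕ) (hl : l ∈ d.eraseIdx i) : l ≠ j := by
      rintro rfl
      obtain ⟨m, hmi, hlm⟩ := List.mem_eraseIdx_iff_getElem?.1 hl
      have hm : m < d.length := (List.getElem?_eq_some_iff.1 hlm).1
      exact hmi ((List.getElem?_inj hm hlt.nodup).1 (hlm.trans h.symm))
    simpa [sub_eq_zero] using hj

theorem pureDiagram_eq_zero {d : List ℕ} {i j : ℕ} (h : d[i]? ≠ some j) :
    pureDiagram d i j = 0 :=
  if_neg h

theorem pureDiagram_nonneg {d : List ℕ} (hd : IsDegreeSequence d) (i j : ℕ) :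
    0 ≤ pureDiagram d i j := by
  by_cases h : d[i]? = some j
  · exact (pureDiagram_pos hd h).le
  · exact (pureDiagram_eq_zero h).ge

theorem IsDecomposition.ne_zero {β : ℕ → ℕ → ℕ} {w : List ℕ →₀ ℝ} (hw : IsDecomposition β w)
    {d : List ℕ} (hd : d ∈ w.support) {i j : ℕ} (h : d[i]? = some j) : β i j ≠ 0 := by
  obtain ⟨hseq, hnonneg, hβ⟩ := hw
  intro hzero
  have hsum := hβ i j
  rw [hzero, Nat.cast_zero, eq_comm, Finsupp.sum, Finset.sum_eq_zero_iff_of_nonneg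
    fun e he => mul_nonneg (hnonneg e) (pureDiagram_nonneg (hseq e he) i j)] at hsum
  exact mul_ne_zero (Finsupp.mem_support_iff.1 hd) (pureDiagram_pos (hseq d hd) h).ne' (hsum d hd)

theorem pureDiagram_cons_zero_zero {d : List ℕ} (hd : IsDegreeSequence (0 :: d)) :
    pureDiagram (0 :: d) 0 0 = 1 := by
  have hpos := pureDiagram_pos hd (i := 0) rfl
  rw [pureDiagram, if_pos List.getElem?_cons_zero] at hpos ⊢
  simp only [List.headD_cons, List.tail_cons, List.eraseIdx_zero, Nat.cast_zero, sub_zero,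
    List.pure_def, List.bind_eq_flatMap, List.map_flatMap, List.map_cons, List.map_nil,
    Nat.abs_cast] at hpos ⊢
  exact div_self fun h => by simp [h] at hpos

theorem isDegreeSequence_translatedSequence {k : ℕ} (hk : k ≠ 0) (s : Fin 8) :
    IsDegreeSequence (translatedSequence k s) := by
  fin_cases s <;> simp [IsDegreeSequence, translatedSequence] <;> omega

end PureDiagram

section Entries

/-- The vector of the entries of a diagram at the positions `pathPosition k`. -/
def pathEntries (k : ℕ) (v : ℕ → ℕ → ℝ) : Fin 9 → ℝ :=
  fun x => v (pathPosition k x).1 (pathPosition k x).2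

/-- The matrix whose columns are the entries of the pure diagrams `π₁(k), …, π₈(k)` at the positions
`pathPosition k`. -/
noncomputable def pureMatrix (k : ℝ) : Matrix (Fin 9) (Fin 8) ℝ :=
  !![1, 1, 1, 1, 1, 1, 1, 1;
    (2 * k + 1) * (k + 1), (2 * k + 1) * (2 * k + 3) / 3, (k + 1) * (2 * k + 3) / 3,
      (2 * k + 1) * (k + 1) * (2 * k + 3) / 3, (2 * k + 1) * (k + 1) * (k + 2) / 2,
      (2 * k + 1) * (2 * k + 3) * (k + 2) / 6, (k + 1) * (2 * k + 3) * (k + 2) / 6,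
      (2 * k + 1) * (k + 1) * (2 * k + 3) * (k + 2) / 6;
    4 * k * (k + 1), k * (2 * k + 3), 0, 2 * k * (k + 1) * (2 * k + 3),
      8 * k * (k + 1) * (k + 2) / 3, 2 * k * (2 * k + 3) * (k + 2) / 3, 0,
      4 * k * (k + 1) * (2 * k + 3) * (k + 2) / 3;
    0, 0, k * (2 * k + 3), 0, 0, 0, k * (2 * k + 3) * (k + 2), 0;
    k * (2 * k + 1), 0, 0, k * (2 * k + 1) * (2 * k + 3), k * (2 * k + 1) * (k + 2), 0, 0,
      k * (2 * k + 1) * (2 * k + 3) * (k + 2);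
    0, k * (2 * k + 1) / 3, 4 * k * (k + 1) / 3, 0, 0, 2 * k * (2 * k + 1) * (k + 2) / 3,
      8 * k * (k + 1) * (k + 2) / 3, 0;
    0, 0, 0, 2 * k * (2 * k + 1) * (k + 1) / 3, 0, 0, 0,
      4 * k * (2 * k + 1) * (k + 1) * (k + 2) / 3;
    0, 0, 0, 0, k * (2 * k + 1) * (k + 1) / 6, k * (2 * k + 1) * (2 * k + 3) / 6,
      k * (k + 1) * (2 * k + 3) / 2, 0;
    0, 0, 0, 0, 0, 0, 0, k * (2 * k + 1) * (k + 1) * (2 * k + 3) / 6]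

theorem pathEntries_translatedSequence {k : ℕ} (hk : k ≠ 0) (s : Fin 8) :
    pathEntries k (pureDiagram (translatedSequence k s)) = (pureMatrix k).col s := by
  funext x
  fin_cases x
  · have hs := isDegreeSequence_translatedSequence hk s
    fin_cases s <;> exact pureDiagram_cons_zero_zero hs
  all_goals
    fin_cases s <;>
    simp only [pathEntries, Matrix.col, Matrix.transpose_apply, pureDiagram, translatedSequence,
      pathPosition, pureMatrix, Fin.reduceFinMk, Matrix.cons_val, Matrix.of_apply, Matrix.cons_val',
      Matrix.cons_val_fin_one, Matrix.cons_val_one, Matrix.cons_val_zero,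
      List.getElem?_cons_zero, List.getElem?_cons_succ, List.getElem?_nil, reduceCtorEq,
      ↓reduceIte, Option.some.injEq, Nat.add_left_cancel_iff, Nat.reduceEqDiff, List.headD_cons,
      List.tail_cons, List.eraseIdx_cons_succ, List.eraseIdx_zero, List.pure_def,
      List.bind_eq_flatMap, List.flatMap_cons, List.flatMap_nil, List.cons_append, List.nil_append,
      List.map_cons, List.map_nil, List.prod_cons, List.prod_nil, Nat.cast_zero, zero_sub, sub_zero,
      abs_neg, Nat.abs_cast] <;>
    norm_num <;> field_simp <;> ring

/-- The vector of the Betti numbers of the `k`-th power of the path ideal at the positions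
`pathPosition k`. -/
noncomputable def bettiVector (k : ℝ) : Fin 9 → ℝ :=
  ![1, (k + 4) * (k + 3) * (k + 2) * (k + 1) / 24, (k + 3) * (k + 2) * (k + 1) * k / 6,
    k * (k + 2), (k + 2) * (k + 1) * k * (k - 1) / 4, 2 * k * (k + 1),
    (k + 1) * k * (k - 1) * (k - 2) / 6, k ^ 2, k * (k - 1) * (k - 2) * (k - 3) / 24]

theorem cast_choose_four (n : ℕ) :
    (n.choose 4 : ℝ) = n * (n - 1) * (n - 2) * (n - 3) / 24 := by
  rw [Nat.cast_choose_eq_descPochhammer_div]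
  simp [descPochhammer_succ_right, Nat.factorial]

theorem pathDiagram_pathPosition (k : ℕ) (x : Fin 9) :
    pathDiagram k (pathPosition k x).1 (pathPosition k x).2 =
      ![1, pathRow₁ k 1, pathRow₁ k 2, pathRow₂ k 2, pathRow₁ k 3, pathRow₂ k 3, pathRow₁ k 4,
        pathRow₂ k 4, pathRow₁ k 5] x := by
  fin_cases x <;> simp [pathDiagram, pathPosition] <;> grind

theorem pathEntries_pathDiagram (k : ℕ) :
    pathEntries k (fun i j => (pathDiagram k i j : ℝ)) = bettiVector k := by
  funext x
  rw [pathEntries, pathDiagram_pathPosition]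
  fin_cases x <;>
    simp [bettiVector, pathRow₁, pathRow₂, cast_choose_four] <;> ring

theorem forall_eq_sum_mul_pureDiagram_iff {k : ℕ} (hk : k ≠ 0) (w : Fin 8 → ℝ) :
    (∀ i j, (pathDiagram k i j : ℝ) = ∑ s, w s * pureDiagram (translatedSequence k s) i j) ↔
      pureMatrix k *ᵥ w = bettiVector k := by
  have hentry (x : Fin 9) : ∑ s, w s * pureDiagram (translatedSequence k s)
      (pathPosition k x).1 (pathPosition k x).2 = (pureMatrix k *ᵥ w) x :=
    Finset.sum_congr rfl fun s _ =>
      (mul_comm _ _).trans (congrArg (· * w s) (congrFun (pathEntries_translatedSequence hk s) x))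
  rw [← pathEntries_pathDiagram, eq_comm, funext_iff]
  refine ⟨fun h x => (h _ _).trans (hentry x), fun h i j => ?_⟩
  by_cases hij : (i, j) ∈ Set.range (pathPosition k)
  · obtain ⟨x, hx⟩ := hij
    have hx' := (h x).trans (hentry x).symm
    rwa [pathEntries, hx] at hx'
  · rw [not_imp_comm.1 mem_range_pathPosition_of_pathDiagram_ne_zero hij, Nat.cast_zero, eq_comm]
    refine Finset.sum_eq_zero fun s _ => mul_eq_zero_of_right _ (pureDiagram_eq_zero fun hs => ?_)
    exact hij (mem_range_pathPosition_of_translatedSequence k s i j hs)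

end Entries

section Moment

/-- The coefficients of the linear functional `∑ (-1) ^ i * (j - 2 * k) ^ 2 * v i j` on diagrams
supported on the positions `pathPosition k`.  It vanishes on the diagrams of the modules of
codimension at least three. -/
def momentWeight (k : ℝ) : Fin 9 → ℝ :=
  ![4 * k ^ 2, 0, 1, 4, -4, -9, 9, 16, -16]

theorem momentWeight_dotProduct_bettiVector (k : ℝ) : momentWeight k ⬝ᵥ bettiVector k = 0 := by
  simp [dotProduct, Fin.sum_univ_succ, momentWeight, bettiVector]
  ring

theorem momentWeight_vecMul_pureMatrix (k : ℝ) : momentWeight k ᵥ* pureMatrix k = 0 := by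
  funext s
  fin_cases s <;>
  · simp [Matrix.vecMul, dotProduct, Fin.sum_univ_succ, momentWeight, pureMatrix]
    ring

theorem momentWeight_dotProduct_pureDiagram_pos {k : ℕ} (hk : k ≠ 0) {d : List ℕ}
    (hd : IsDegreeSequence d) (hhead : d[0]? = some 0) (hlen : d.length ≤ 3) :
    0 < momentWeight k ⬝ᵥ pathEntries k (pureDiagram d) := by
  refine Finset.sum_pos' (fun x _ => ?_) ⟨0, Finset.mem_univ 0, ?_⟩
  · by_cases hx : x < 4
    · have hweight : 0 ≤ momentWeight k x := by
        fin_cases x <;> simp [momentWeight] at hx ⊢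
      exact mul_nonneg hweight (pureDiagram_nonneg hd _ _)
    · have hcolumn : 3 ≤ (pathPosition k x).1 := by
        fin_cases x <;> simp [pathPosition] at hx ⊢
      refine (mul_eq_zero_of_right _ (pureDiagram_eq_zero ?_)).ge
      simp [List.getElem?_eq_none (hlen.trans hcolumn)]
  · have hweight : 0 < momentWeight k 0 := by
      change (0 : ℝ) < 4 * k ^ 2
      positivity
    exact mul_pos hweight (pureDiagram_pos hd hhead)

theorem IsDecomposition.dotProduct_pathEntries {β : ℕ → ℕ → ℕ} {w : List ℕ →₀ ℝ}
    (hw : IsDecomposition β w) (k : ℕ) (c : Fin 9 → ℝ) :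
    c ⬝ᵥ pathEntries k (fun i j => (β i j : ℝ)) =
      ∑ d ∈ w.support, w d * c ⬝ᵥ pathEntries k (pureDiagram d) := by
  have hβ : pathEntries k (fun i j => (β i j : ℝ)) =
      ∑ d ∈ w.support, w d • pathEntries k (pureDiagram d) := by
    funext x
    simp [pathEntries, hw.2.2, Finsupp.sum]
  simp only [hβ, dotProduct_sum, dotProduct_smul, smul_eq_mul]

theorem IsDecomposition.mem_range_translatedSequence {k : ℕ} (hk : k ≠ 0) {w : List ℕ →₀ ℝ}
    (hw : IsDecomposition (pathDiagram k) w) {d : List ℕ} (hd : d ∈ w.support) :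
    d ∈ Set.range (translatedSequence k) := by
  set μ : List ℕ → ℝ := fun d => momentWeight k ⬝ᵥ pathEntries k (pureDiagram d)
  have hposition {d} (hd : d ∈ w.support) (i j : ℕ) (h : d[i]? = some j) :
      (i, j) ∈ Set.range (pathPosition k) :=
    mem_range_pathPosition_of_pathDiagram_ne_zero (hw.ne_zero hd h)
  have hshort {d} (hd : d ∈ w.support) (hlen : d.length ≤ 3) : 0 < μ d := by
    refine momentWeight_dotProduct_pureDiagram_pos hk (hw.1 d hd) ?_ hlen
    have hhead := List.getElem?_eq_getElem (List.length_pos_iff.2 (hw.1 d hd).1)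
    simpa [hhead] using mem_range_pathPosition.1 (hposition hd 0 _ hhead)
  have hlong {d} (hd : d ∈ w.support) (hlen : 3 < d.length) :
      d ∈ Set.range (translatedSequence k) :=
    mem_range_translatedSequence_of_forall_mem_range_pathPosition (hw.1 d hd) hlen (hposition hd)
  have hnonneg (d : List ℕ) (hd : d ∈ w.support) : 0 ≤ w d * μ d := by
    refine mul_nonneg (hw.2.1 d) ?_
    obtain hlen | hlen := le_or_gt d.length 3
    · exact (hshort hd hlen).le
    · obtain ⟨s, rfl⟩ := hlong hd hlen
      simp only [μ, pathEntries_translatedSequence hk]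
      exact (congrFun (momentWeight_vecMul_pureMatrix k) s).ge
  have hsum : ∑ d ∈ w.support, w d * μ d = 0 := by
    rw [← hw.dotProduct_pathEntries, pathEntries_pathDiagram, momentWeight_dotProduct_bettiVector]
  refine hlong hd (not_le.1 fun hlen => ?_)
  exact mul_ne_zero (Finsupp.mem_support_iff.1 hd) (hshort hd hlen).ne'
    ((Finset.sum_eq_zero_iff_of_nonneg hnonneg).1 hsum d hd)

end Moment

section Polytope

/-- The vertices of the polytope of decompositions. -/
noncomputable def hVertex (k : ℝ) : Fin 3 → Fin 8 → ℝ :=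
  ![hVertex₁ k, hVertex₂ k, hVertex₃ k]

theorem range_hVertex (k : ℝ) :
    Set.range (hVertex k) = {hVertex₁ k, hVertex₂ k, hVertex₃ k} := by
  simp only [hVertex, Matrix.range_cons, Matrix.range_empty, Set.union_empty, Set.singleton_union]

theorem hVertex_nonneg {k : ℝ} (hk : 3 ≤ k) (i : Fin 3) (s : Fin 8) : 0 ≤ hVertex k i s := by
  obtain ⟨m, hm, rfl⟩ : ∃ m : ℝ, 0 ≤ m ∧ k = m + 3 := ⟨k - 3, by linarith, by ring⟩
  have sub_one : m + 3 - 1 = m + 2 := by ring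
  have sub_two : m + 3 - 2 = m + 1 := by ring
  have sq_sub_seven : (m + 3) ^ 2 - 7 = m ^ 2 + 6 * m + 2 := by ring
  fin_cases i <;> fin_cases s <;>
  · simp only [hVertex, hVertex₁, hVertex₂, hVertex₃, wCoord₄, wCoord₈, Fin.reduceFinMk,
      Matrix.cons_val, Fin.zero_eta, Fin.mk_one, sub_one, sub_two, add_sub_cancel_right,
      sq_sub_seven]
    positivity

theorem pureMatrix_mulVec_hVertex {k : ℝ} (hk : 0 < k) (i : Fin 3) :
    pureMatrix k *ᵥ hVertex k i = bettiVector k := by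
  funext x
  fin_cases i <;> fin_cases x <;>
    simp [Matrix.mulVec, dotProduct, Fin.sum_univ_eight, pureMatrix, bettiVector, hVertex,
      hVertex₁, hVertex₂, hVertex₃, wCoord₄, wCoord₈] <;> field_simp <;> ring

/-- The matrix that sends a point of the affine span of the three vertices to its barycentric
coordinates.  Each vertex has a single nonzero entry among its first three, whence the shape of the
matrix. -/
noncomputable def barycentricMatrix (k : ℝ) : Matrix (Fin 3) (Fin 8) ℝ :=
  !![0, 0, (2 * k + 3) / (k + 2), 0, 0, 0, 0, 0;
    0, (2 * k + 3) * (2 * k + 1) / (2 * (k + 2) * (k + 1)), 0, 0, 0, 0, 0, 0;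
    (2 * k + 1) / (k + 2), 0, 0, 0, 0, 0, 0, 0]

theorem barycentricMatrix_nonneg {k : ℝ} (hk : 0 ≤ k) (i : Fin 3) (s : Fin 8) :
    0 ≤ barycentricMatrix k i s := by
  fin_cases i <;> fin_cases s <;>
  · simp only [barycentricMatrix, Matrix.of_apply, Matrix.cons_val, Fin.reduceFinMk, Fin.zero_eta,
      Fin.mk_one]
    positivity

theorem barycentricMatrix_mulVec_hVertex {k : ℝ} (hk : 0 < k) (i : Fin 3) :
    barycentricMatrix k *ᵥ hVertex k i = Pi.single i 1 := by
  funext j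
  fin_cases i <;> fin_cases j <;>
    simp [Matrix.mulVec, dotProduct, Fin.sum_univ_eight, barycentricMatrix, hVertex,
      hVertex₁, hVertex₂, hVertex₃] <;> field_simp

theorem sum_barycentricMatrix_mulVec {k : ℝ} (hk : 0 < k) {w : Fin 8 → ℝ}
    (hw : pureMatrix k *ᵥ w = bettiVector k) : ∑ i, (barycentricMatrix k *ᵥ w) i = 1 := by
  set c : Fin 9 → ℝ := (2 * (k + 1) * (k + 2) * k)⁻¹ • ![0, 0, 0, -2 * (k + 1), 2 * (k + 1),
    3 * (2 * k + 3), -3 * (2 * k + 3), -12 * (k + 2), 12 * (k + 2)] with hc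
  have hpure : 1 ᵥ* barycentricMatrix k = c ᵥ* pureMatrix k := by
    funext s
    fin_cases s <;>
      simp [hc, Matrix.vecMul, dotProduct, Fin.sum_univ_succ, barycentricMatrix, pureMatrix] <;>
      field_simp <;> ring
  have hbetti : c ⬝ᵥ bettiVector k = 1 := by
    simp [hc, dotProduct, Fin.sum_univ_succ, bettiVector]
    field_simp
    ring
  calc ∑ i, (barycentricMatrix k *ᵥ w) i = 1 ⬝ᵥ barycentricMatrix k *ᵥ w :=
        (one_dotProduct _).symm
    _ = (c ᵥ* pureMatrix k) ⬝ᵥ w := by rw [Matrix.dotProduct_mulVec, hpure]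
    _ = 1 := by rw [← Matrix.dotProduct_mulVec, hw, hbetti]

theorem eq_zero_of_pureMatrix_mulVec_eq_zero {k : ℝ} (hk : 0 < k) {v : Fin 8 → ℝ}
    (hv : pureMatrix k *ᵥ v = 0) (hv' : barycentricMatrix k *ᵥ v = 0) : v = 0 := by
  have h₁ : k + 1 ≠ 0 := by positivity
  have h₂ : k + 2 ≠ 0 := by positivity
  have h₃ : 2 * k + 1 ≠ 0 := by positivity
  have h₄ : 2 * k + 3 ≠ 0 := by positivity
  have v0 : v 0 = 0 := by
    simpa [Matrix.mulVec, dotProduct, Fin.sum_univ_eight, barycentricMatrix, *] using congrFun hv' 2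
  have v1 : v 1 = 0 := by
    simpa [Matrix.mulVec, dotProduct, Fin.sum_univ_eight, barycentricMatrix, *] using congrFun hv' 1
  have v2 : v 2 = 0 := by
    simpa [Matrix.mulVec, dotProduct, Fin.sum_univ_eight, barycentricMatrix, *] using congrFun hv' 0
  have v7 : v 7 = 0 := by
    simpa [Matrix.mulVec, dotProduct, Fin.sum_univ_eight, pureMatrix, hk.ne', *] using congrFun hv 8
  have v3 : v 3 = 0 := by
    simpa [Matrix.mulVec, dotProduct, Fin.sum_univ_eight, pureMatrix, hk.ne', *] using congrFun hv 6
  have v6 : v 6 = 0 := by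
    simpa [Matrix.mulVec, dotProduct, Fin.sum_univ_eight, pureMatrix, hk.ne', *] using congrFun hv 3
  have v4 : v 4 = 0 := by
    simpa [Matrix.mulVec, dotProduct, Fin.sum_univ_eight, pureMatrix, hk.ne', *] using congrFun hv 4
  have v5 : v 5 = 0 := by
    simpa [Matrix.mulVec, dotProduct, Fin.sum_univ_eight, pureMatrix, hk.ne', *] using congrFun hv 5
  funext s
  fin_cases s <;> assumption

theorem eq_sum_smul_hVertex {k : ℝ} (hk : 0 < k) {w : Fin 8 → ℝ}
    (hw : pureMatrix k *ᵥ w = bettiVector k) :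
    w = ∑ i, (barycentricMatrix k *ᵥ w) i • hVertex k i := by
  rw [← sub_eq_zero]
  apply eq_zero_of_pureMatrix_mulVec_eq_zero hk
  · simp only [Matrix.mulVec_sub, Matrix.mulVec_sum, Matrix.mulVec_smul,
      pureMatrix_mulVec_hVertex hk, hw, ← Finset.sum_smul, sum_barycentricMatrix_mulVec hk hw,
      one_smul, sub_self]
  · simp only [Matrix.mulVec_sub, Matrix.mulVec_sum, Matrix.mulVec_smul,
      barycentricMatrix_mulVec_hVertex hk, sub_eq_zero]
    exact pi_eq_sum_univ' _

theorem affineIndependent_hVertex {k : ℝ} (hk : 0 < k) :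
    AffineIndependent ℝ (hVertex k) := by
  have hcomp : LinearIndependent ℝ ((barycentricMatrix k).mulVecLin ∘ hVertex k) := by
    convert (Pi.basisFun ℝ (Fin 3)).linearIndependent using 1
    funext i
    simp [barycentricMatrix_mulVec_hVertex hk]
  exact (hcomp.of_comp _).affineIndependent

theorem convex_decompositionPolytope {m : ℕ} (β : ℕ → ℕ → ℕ) (D : Fin m → List ℕ) :
    Convex ℝ (decompositionPolytope β D) := by
  rintro x ⟨hx, hxβ⟩ y ⟨hy, hyβ⟩ a b ha hb hab
  refine ⟨fun s => add_nonneg (mul_nonneg ha (hx s)) (mul_nonneg hb (hy s)), fun i j => ?_⟩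
  have hsum : ∑ s, (a • x + b • y) s * pureDiagram (D s) i j =
      a * ∑ s, x s * pureDiagram (D s) i j + b * ∑ s, y s * pureDiagram (D s) i j := by
    simp only [Finset.mul_sum, ← Finset.sum_add_distrib, Pi.add_apply, Pi.smul_apply, smul_eq_mul,
      add_mul, mul_assoc]
  rw [hsum, ← hxβ, ← hyβ, ← add_mul, hab, one_mul]

theorem decompositionPolytope_eq_convexHull {k : ℕ} (hk : 3 ≤ k) :
    decompositionPolytope (pathDiagram k) (translatedSequence k) =
      convexHull ℝ (Set.range (hVertex k)) := by
  have hpos : (0 : ℝ) < k := by exact_mod_cast (by omega : 0 < k)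
  have hmem (w : Fin 8 → ℝ) : w ∈ decompositionPolytope (pathDiagram k) (translatedSequence k) ↔
      (∀ s, 0 ≤ w s) ∧ pureMatrix k *ᵥ w = bettiVector k :=
    and_congr_right fun _ => forall_eq_sum_mul_pureDiagram_iff (by omega) w
  apply Set.Subset.antisymm
  · intro w hw
    obtain ⟨hnonneg, hsolution⟩ := (hmem w).1 hw
    rw [eq_sum_smul_hVertex hpos hsolution]
    refine (convex_convexHull ℝ _).sum_mem (fun i _ => ?_)
      (sum_barycentricMatrix_mulVec hpos hsolution)
      fun i _ => subset_convexHull ℝ _ (Set.mem_range_self i)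
    rw [Matrix.mulVec, dotProduct]
    exact Finset.sum_nonneg fun s _ => mul_nonneg (barycentricMatrix_nonneg hpos.le i s) (hnonneg s)
  · refine convexHull_min ?_ (convex_decompositionPolytope _ _)
    rintro _ ⟨i, rfl⟩
    exact (hmem _).2 ⟨hVertex_nonneg (by exact_mod_cast hk) i, pureMatrix_mulVec_hVertex hpos i⟩

end Polytope

theorem mainTheorem2 {K : Type*} [Field K] (k : ℕ) (hk : 1 ≤ k) :
    Nonempty (MinimalFreeResolution K 6 (pathIdeal K ^ k)) ∧
    ∀ F : MinimalFreeResolution K 6 (pathIdeal K ^ k),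
      (∀ i j, F.betti i j = pathDiagram k i j) ∧
      (∀ w : List ℕ →₀ ℝ, IsDecomposition F.betti w →
        ∀ d ∈ w.support, d ∈ Set.range (translatedSequence k)) ∧
      (3 ≤ k →
        decompositionPolytope F.betti (translatedSequence k) =
            convexHull ℝ {hVertex₁ (k : ℝ), hVertex₂ (k : ℝ), hVertex₃ (k : ℝ)} ∧
          AffineIndependent ℝ ![hVertex₁ (k : ℝ), hVertex₂ (k : ℝ), hVertex₃ (k : ℝ)]) := by
  have hk0 : k ≠ 0 := Nat.one_le_iff_ne_zero.1 hk
  obtain ⟨G, -⟩ := hasTable_pathPowerSet K hk0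
  refine ⟨⟨G.toMinimalFreeResolution (mem_pathIdeal_pow_iff K k)⟩, fun F => ?_⟩
  have hbetti : F.betti = pathDiagram k := by
    funext i j
    exact betti_pathIdeal_pow hk0 F i j
  rw [hbetti]
  exact ⟨fun _ _ => rfl, fun w hw d hd => hw.mem_range_translatedSequence hk0 hd, fun hk3 =>
    ⟨by rw [decompositionPolytope_eq_convexHull hk3, range_hVertex],
      affineIndependent_hVertex (by exact_mod_cast hk)⟩⟩
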